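/- Let $N\ge 1$ and let $\alpha,\eta,\theta,R$ be real $N\times N$ matrices with $\alpha^{T}=\alpha>0$, $\eta^{T}=\eta>0$, $\theta^{T}=-\theta$, $R^{T}=R\ge 0$ and $0<N_R:=\operatorname{rank}R<N$. For $\beta\ge 0$ consider the system $$\alpha\ddot Q+(2\theta+\beta R)\dot Q+\eta Q=0,\qquad Q(t)\in\mathbb C^N, \tag{1}$$ whose eigenmodes are the solutions $Q(t)=qe^{-i\zeta t}$ with $0\ne q\in\mathbb C^N$. On $H=\mathbb C^{2N}$ put $A(\beta)=\Omega-i\beta B$, where, with $K_p=\sqrt{\alpha}^{\,-1}$ and $\Phi=\sqrt{\eta}\,K_p^{T}$, $$\Omega=\begin{bmatrix}-2iK_p\theta K_p^{T}&-i\Phi^{T}\\ i\Phi&0\end{bmatrix},\qquad B=\begin{bmatrix}K_pRK_p^{T}&0\\0&0\end{bmatrix}.$$ Let $\omega_{\max}$ and $\omega_{\min}$ be the largest and the smallest positive eigenvalue of $\Omega$, let $b_{\min}$ be the smallest nonzero eigenvalue of $B$, let $P_B^{\perp}$ be the orthogonal projection of $H$ onto $\operatorname{Ker}B$, and let $\rho_{\min}$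 be the smallest positive eigenvalue of $P_B^{\perp}\Omega P_B^{\perp}$. For $y>0$ put $$c^{-1}(y)=\frac{2\omega_{\max}^2}{b_{\min}}\,y^{-1}+\frac{2\omega_{\max}}{b_{\min}},$$ which is the inverse of $c(\beta)=\frac{2\omega_{\max}^2}{b_{\min}}\bigl(\beta-\frac{2\omega_{\max}}{b_{\min}}\bigr)^{-1}$, $\beta>\frac{2\omega_{\max}}{b_{\min}}$. A superscript $\flat$ denotes the same object for the dual system, obtained from (1) by interchanging $\alpha$ and $\eta$. For an eigenvalue $\zeta$ of $A(\beta)$ the quality factor is $Q_\zeta=\frac12\,\frac{|\operatorname{Re}\zeta|}{-\operatorname{Im}\zeta}$, with $Q_\zeta=+\infty$ if $\operatorname{Im}\zeta=0\ne\operatorname{Re}\zeta$ and $Q_\zeta=0$ if $\zeta=0$. Define $$\beta_2=\max\Bigl\{\min\bigl\{c^{-1}(\rho_{\min}/2),\,(c^{\flat})^{-1}(\rho^{\flat}_{\min}/2)\bigr\},\ \frac{2\omega_{\max}}{b_{\min}},\ \frac{2\omega^{\flat}_{\max}}{b^{\flat}_{\min}}\Bigr\}.$$ Then for every $\beta>\beta_2$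 the following hold. 1. Let $\sigma_0$ be the set of $\zeta\in\sigma(A(\beta))$ with $|\zeta|\le\omega_{\max}$, and $\sigma_1$ the set of $\zeta\in\sigma(A(\beta))$ with $|\zeta+i\beta b|\le\omega_{\max}$ for some nonzero eigenvalue $b$ of $B$. Then $\sigma(A(\beta))=\sigma_0\cup\sigma_1$ and $\sigma_0\cap\sigma_1=\emptyset$, and there are unique $A(\beta)$-invariant subspaces $H_{h\ell}(\beta)$, $H_{\ell\ell}(\beta)$ with $H=H_{h\ell}(\beta)\oplus H_{\ell\ell}(\beta)$, $\sigma(A(\beta)|_{H_{\ell\ell}(\beta)})=\sigma_0$ and $\sigma(A(\beta)|_{H_{h\ell}(\beta)})=\sigma_1$. Here $\dim H_{h\ell}(\beta)=N_R$ and $\dim H_{\ell\ell}(\beta)=2N-N_R$. 2. There are unique $A(\beta)$-invariant subspaces $H_{\ell\ell,0}(\beta)$, $H_{\ell\ell,1}(\beta)$ with $H_{\ell\ell}(\beta)=H_{\ell\ell,0}(\beta)\oplus H_{\ell\ell,1}(\beta)$, $\sigma(A(\beta)|_{H_{\ell\ell,0}(\beta)})=\{\zeta\in\sigma(A(\beta)):|\zeta|<\omega_{\min}\}$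 and $\sigma(A(\beta)|_{H_{\ell\ell,1}(\beta)})=\{\zeta\in\sigma(A(\beta)):\omega_{\min}\le|\zeta|\le\omega_{\max}\}$. Their dimensions are $N_R$ and $2N-2N_R$, respectively. Moreover $$\sigma(A|_{H_{\ell\ell,0}})=-\overline{\sigma(A|_{H_{\ell\ell,0}})}=-\sigma(A^{\flat}|_{H^{\flat}_{h\ell}})^{-1},\qquad \sigma(A|_{H_{h\ell}})=-\overline{\sigma(A|_{H_{h\ell}})}=-\sigma(A^{\flat}|_{H^{\flat}_{\ell\ell,0}})^{-1},$$ $$\sigma(A|_{H_{\ell\ell,1}})=-\overline{\sigma(A|_{H_{\ell\ell,1}})}=-\sigma(A^{\flat}|_{H^{\flat}_{\ell\ell,1}})^{-1},$$ where all operators and subspaces are taken at $\beta$, the bar is complex conjugation, and operations on sets are elementwise. 3. The minimum of $Q_\zeta$ over $\zeta\in\sigma(A(\beta)|_{H_{\ell\ell,1}(\beta)})$ exists and is greater than $\frac12$; thus every such $\zeta$ has $Q_\zeta>\frac12$. In particular $\operatorname{Re}\zeta\ne0$ for every such $\zeta$. Consequently these modes are underdamped: if $\zeta(\beta)\in\sigma(A(\beta)|_{H_{\ell\ell,1}(\beta)})$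 for all $\beta>\beta_2$, then there is $\beta'\ge0$ such that for all $\beta>\beta'$ system (1) has an eigenmode with time dependency $e^{-i\zeta(\beta)t}$ and $\operatorname{Re}\zeta(\beta)\neq0$. -/

import Mathlib

open scoped MatrixOrder

noncomputable section

/-- A linear Lagrangian system `α Q'' + (2 θ + β R) Q' + η Q = 0` with `N` degrees of freedom:
real `N × N` matrices with `αᵀ = α > 0`, `ηᵀ = η ≥ 0`, `θᵀ = -θ`, `Rᵀ = R ≥ 0`, `rank R > 0`. -/
structure LagrangianSystem (N : ℕ) where
  α : Matrix (Fin N) (Fin N) ℝ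
  η : Matrix (Fin N) (Fin N) ℝ
  θ : Matrix (Fin N) (Fin N) ℝ
  R : Matrix (Fin N) (Fin N) ℝ
  α_posDef : α.PosDef
  η_posSemidef : η.PosSemidef
  θ_skew : θ.transpose = -θ
  R_posSemidef : R.PosSemidef
  R_rank_pos : 0 < R.rank

/-- The state space `H = ℂ^{2N} = ℂ^N ⊕ ℂ^N` with the standard inner product. -/
abbrev StateSpace (N : ℕ) : Type := EuclideanSpace ℂ (Fin N ⊕ Fin N)

/-- The set of eigenvalues of the restriction `T|_W`, for an invariant subspace `W` of `T`. -/
def restrictedSpectrum {V : Type*} [AddCommGroup V] [Module ℂ V]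
    (T : Module.End ℂ V) (W : Submodule ℂ V) : Set ℂ :=
  {ζ | ∃ w ∈ W, w ≠ 0 ∧ T w = ζ • w}

/-- On an invariant subspace of a finite-dimensional space, `restrictedSpectrum` is the spectrum
of the restricted operator. -/
theorem restrictedSpectrum_eq_spectrum {V : Type*} [AddCommGroup V] [Module ℂ V]
    [FiniteDimensional ℂ V] (T : Module.End ℂ V) (W : Submodule ℂ V) (hW : ∀ w ∈ W, T w ∈ W) :
    restrictedSpectrum T W = spectrum ℂ (T.restrict hW : Module.End ℂ W) := by
  ext ζ
  rw [← Module.End.hasEigenvalue_iff_mem_spectrum]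
  constructor
  · rintro ⟨w, hw, h0, h⟩
    refine Module.End.hasEigenvalue_of_hasEigenvector (x := (⟨w, hw⟩ : W)) ?_
    refine ⟨Module.End.mem_eigenspace_iff.2 (Subtype.ext ?_), ?_⟩
    · simpa using h
    · simpa [Subtype.ext_iff] using h0
  · intro h
    obtain ⟨w, hw⟩ := h.exists_hasEigenvector
    refine ⟨w, w.2, ?_, ?_⟩
    · simpa using hw.2
    · have := congrArg Subtype.val hw.apply_eq_smul
      simpa using this

/-- The sum of the algebraic (generalized) eigenspaces of `T` over the eigenvalues in `s`. -/
def spectralSubspace {V : Type*} [AddCommGroup V] [Module ℂ V]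
    (T : Module.End ℂ V) (s : Set ℂ) : Submodule ℂ V :=
  ⨆ ζ ∈ s, T.maxGenEigenspace ζ

/-- The quality factor `(1/2) |Re ζ| / (-Im ζ)`, with the convention that it is `+∞` if
`Im ζ = 0` and `Re ζ ≠ 0`, and `0` if `ζ = 0`. -/
def qFactor (ζ : ℂ) : EReal :=
  if ζ = 0 then 0
  else if ζ.im = 0 then ⊤
  else (((1 / 2) * (|ζ.re| / (-ζ.im)) : ℝ) : EReal)

namespace LagrangianSystem

variable {N : ℕ} (S : LagrangianSystem N)

/-- The dual system, obtained by interchanging `α` and `η`. -/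
def dual (h : S.η.PosDef) : LagrangianSystem N where
  α := S.η
  η := S.α
  θ := S.θ
  R := S.R
  α_posDef := h
  η_posSemidef := S.α_posDef.posSemidef
  θ_skew := S.θ_skew
  R_posSemidef := S.R_posSemidef
  R_rank_pos := S.R_rank_pos

/-! The equations of motion and their eigenmodes. -/

/-- `Q : ℝ → ℂ^N` is a solution of the equations of motion with loss parameter `β`. -/
def IsSolution (β : ℝ) (Q : ℝ → Fin N → ℂ) : Prop :=
  ContDiff ℝ 2 Q ∧ ∀ t : ℝ,
    (S.α.map Complex.ofReal).mulVec (deriv (deriv Q) t)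
      + (((2 : ℝ) • S.θ + β • S.R).map Complex.ofReal).mulVec (deriv Q t)
      + (S.η.map Complex.ofReal).mulVec (Q t) = 0

/-- `Q(t) = q e^{-iζt}`, `q ≠ 0`, is an eigenmode of the system with loss parameter `β`. -/
def IsEigenmode (β : ℝ) (ζ : ℂ) (q : Fin N → ℂ) : Prop :=
  q ≠ 0 ∧ S.IsSolution β (fun t : ℝ => Complex.exp (-Complex.I * ζ * t) • q)

/-- The modes with time dependency `e^{-iζ(β)t}` are underdamped: from some `β'` on, `ζ(β)` belongs
to an eigenmode and has nonzero frequency `Re ζ(β)`. -/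
def IsUnderdamped (ζ : ℝ → ℂ) : Prop :=
  ∃ β' : ℝ, 0 ≤ β' ∧ ∀ β : ℝ, β' < β → (∃ q, S.IsEigenmode β (ζ β) q) ∧ (ζ β).re ≠ 0

/-! The canonical system `∂ₜ v = -i A(β) v`, `A(β) = Ω - i β B`. -/

/-- `K_p = (√α)⁻¹`. -/
def Kp : Matrix (Fin N) (Fin N) ℝ := (CFC.sqrt S.α)⁻¹

/-- `K_q = √η`. -/
def Kq : Matrix (Fin N) (Fin N) ℝ := CFC.sqrt S.η

/-- `Φ = K_q K_pᵀ`. -/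
def Phi : Matrix (Fin N) (Fin N) ℝ := S.Kq * S.Kp.transpose

/-- `Ω_p = -2i K_p θ K_pᵀ`. -/
def OmegaP : Matrix (Fin N) (Fin N) ℂ :=
  (-(2 * Complex.I)) • (S.Kp * S.θ * S.Kp.transpose).map Complex.ofReal

/-- The matrix `Ω = [Ω_p, -iΦᵀ; iΦ, 0]`. -/
def OmegaMatrix : Matrix (Fin N ⊕ Fin N) (Fin N ⊕ Fin N) ℂ :=
  Matrix.fromBlocks S.OmegaP ((-Complex.I) • S.Phi.transpose.map Complex.ofReal)
    (Complex.I • S.Phi.map Complex.ofReal) 0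

/-- The matrix `B = [K_p R K_pᵀ, 0; 0, 0]`. -/
def BMatrix : Matrix (Fin N ⊕ Fin N) (Fin N ⊕ Fin N) ℂ :=
  Matrix.fromBlocks ((S.Kp * S.R * S.Kp.transpose).map Complex.ofReal) 0 0 0

/-- `Ω` as an operator on `H`. -/
def Omega : Module.End ℂ (StateSpace N) := Matrix.toEuclideanLin S.OmegaMatrix

/-- `B` as an operator on `H`. -/
def B : Module.End ℂ (StateSpace N) := Matrix.toEuclideanLin S.BMatrix

/-- The system operator `A(β) = Ω - i β B`. -/
def A (β : ℝ) : Module.End ℂ (StateSpace N) := S.Omega - (Complex.I * (β : ℂ)) • S.B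

/-- `P_B^⊥ Ω P_B^⊥`, where `P_B^⊥` is the orthogonal projection of `H` onto `Ker B`. -/
def compressedOmega : Module.End ℂ (StateSpace N) :=
  ((LinearMap.ker S.B).starProjection : Module.End ℂ (StateSpace N)) * S.Omega *
    ((LinearMap.ker S.B).starProjection : Module.End ℂ (StateSpace N))

/-! Spectral constants. -/

/-- `ω_max`, the largest eigenvalue of `Ω`. -/
def omegaMax : ℝ := sSup {ω : ℝ | (ω : ℂ) ∈ spectrum ℂ S.Omega}

/-- `ω_min`, the smallest positive eigenvalue of `Ω`. -/
def omegaMin : ℝ := sInf {ω : ℝ | 0 < ω ∧ (ω : ℂ) ∈ spectrum ℂ S.Omega}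

/-- `b_min`, the smallest nonzero eigenvalue of `B`. -/
def bMin : ℝ := sInf {b : ℝ | b ≠ 0 ∧ (b : ℂ) ∈ spectrum ℂ S.B}

/-- `ρ_min`, the smallest positive eigenvalue of `P_B^⊥ Ω P_B^⊥`. -/
def rhoMin : ℝ := sInf {ρ : ℝ | 0 < ρ ∧ (ρ : ℂ) ∈ spectrum ℂ S.compressedOmega}

/-- `c(β) = (2 ω_max² / b_min) (β - 2 ω_max / b_min)⁻¹`, for `β > 2 ω_max / b_min`. -/
def c (β : ℝ) : ℝ := (2 * S.omegaMax ^ 2 / S.bMin) * (β - 2 * S.omegaMax / S.bMin)⁻¹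

/-- `c⁻¹(y) = (2 ω_max² / b_min) y⁻¹ + 2 ω_max / b_min`, for `y > 0`. -/
def cInv (y : ℝ) : ℝ := (2 * S.omegaMax ^ 2 / S.bMin) * y⁻¹ + 2 * S.omegaMax / S.bMin

theorem c_cInv (hω : S.omegaMax ≠ 0) (hb : S.bMin ≠ 0) {y : ℝ} (hy : 0 < y) :
    S.c (S.cInv y) = y := by
  unfold c cInv
  field_simp
  simp [hω]

theorem cInv_c (hω : S.omegaMax ≠ 0) (hb : S.bMin ≠ 0) {β : ℝ}
    (hβ : 2 * S.omegaMax / S.bMin < β) : S.cInv (S.c β) = β := by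
  have h : β - 2 * S.omegaMax / S.bMin ≠ 0 := (sub_pos.2 hβ).ne'
  have h2 : 2 * S.omegaMax ^ 2 / S.bMin ≠ 0 := by positivity
  unfold c cInv
  rw [mul_inv, inv_inv, mul_inv_cancel_left₀ h2]
  ring

/-- The threshold `β₂`. -/
def beta2 (h : S.η.PosDef) : ℝ :=
  max (min (S.cInv (S.rhoMin / 2)) ((S.dual h).cInv ((S.dual h).rhoMin / 2)))
    (max (2 * S.omegaMax / S.bMin) (2 * (S.dual h).omegaMax / (S.dual h).bMin))

/-! First splitting: high-loss and low-loss subspaces. -/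

/-- `σ₀(A(β))`: the spectrum in the disc of radius `ω_max` about `0`. -/
def sigma0 (β : ℝ) : Set ℂ := spectrum ℂ (S.A β) ∩ Metric.closedBall 0 S.omegaMax

/-- `σ₁(A(β))`: the spectrum in the discs of radius `ω_max` about the points `-iβb`,
`b` a nonzero eigenvalue of `B`. -/
def sigma1 (β : ℝ) : Set ℂ :=
  spectrum ℂ (S.A β) ∩
    ⋃ b ∈ {b : ℝ | b ≠ 0 ∧ (b : ℂ) ∈ spectrum ℂ S.B},
      Metric.closedBall (-(Complex.I * (β : ℂ) * (b : ℂ))) S.omegaMax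

/-- The defining properties of the high-loss and low-loss subspaces. -/
structure IsSplittingI (β : ℝ) (Hh Hl : Submodule ℂ (StateSpace N)) : Prop where
  invariant_h : ∀ w ∈ Hh, S.A β w ∈ Hh
  invariant_l : ∀ w ∈ Hl, S.A β w ∈ Hl
  isCompl : IsCompl Hh Hl
  spectrum_l : restrictedSpectrum (S.A β) Hl = S.sigma0 β
  spectrum_h : restrictedSpectrum (S.A β) Hh = S.sigma1 β

/-- The high-loss subspace `H_{hℓ}(β)`. -/
def Hhl (β : ℝ) : Submodule ℂ (StateSpace N) := spectralSubspace (S.A β) (S.sigma1 β)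

/-- The low-loss subspace `H_{ℓℓ}(β)`. -/
def Hll (β : ℝ) : Submodule ℂ (StateSpace N) := spectralSubspace (S.A β) (S.sigma0 β)

/-- Modal dichotomy: the spectrum of `A(β)` splits into the disjoint sets `σ₀` and `σ₁`, and
`H_{hℓ}(β)`, `H_{ℓℓ}(β)` are the unique invariant subspaces realizing this splitting; their
dimensions are `N_R` and `2N - N_R`. -/
structure ModalDichotomyI (β : ℝ) : Prop where
  spectrum_union : spectrum ℂ (S.A β) = S.sigma0 β ∪ S.sigma1 β
  spectrum_disjoint : S.sigma0 β ∩ S.sigma1 β = ∅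
  splitting : S.IsSplittingI β (S.Hhl β) (S.Hll β)
  unique : ∀ Hh Hl, S.IsSplittingI β Hh Hl → Hh = S.Hhl β ∧ Hl = S.Hll β
  finrank_h : Module.finrank ℂ (S.Hhl β) = S.R.rank
  finrank_l : Module.finrank ℂ (S.Hll β) = 2 * N - S.R.rank

/-! Second splitting: low-loss/low-Q and low-loss/high-Q subspaces. -/

/-- The eigenvalues `ζ` of `A(β)` with `|ζ| < ω_min`. -/
def sigmaLow (β : ℝ) : Set ℂ := spectrum ℂ (S.A β) ∩ {ζ | ‖ζ‖ < S.omegaMin}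

/-- The eigenvalues `ζ` of `A(β)` with `ω_min ≤ |ζ| ≤ ω_max`. -/
def sigmaMid (β : ℝ) : Set ℂ :=
  spectrum ℂ (S.A β) ∩ {ζ | S.omegaMin ≤ ‖ζ‖ ∧ ‖ζ‖ ≤ S.omegaMax}

/-- The defining properties of the low-loss/low-Q and low-loss/high-Q subspaces. -/
structure IsSplittingII (β : ℝ) (H0 H1 : Submodule ℂ (StateSpace N)) : Prop where
  invariant_0 : ∀ w ∈ H0, S.A β w ∈ H0
  invariant_1 : ∀ w ∈ H1, S.A β w ∈ H1
  sup_eq : H0 ⊔ H1 = S.Hll β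
  disjoint : Disjoint H0 H1
  spectrum_0 : restrictedSpectrum (S.A β) H0 = S.sigmaLow β
  spectrum_1 : restrictedSpectrum (S.A β) H1 = S.sigmaMid β

/-- The low-loss/low-Q subspace `H_{ℓℓ,0}(β)`. -/
def Hll0 (β : ℝ) : Submodule ℂ (StateSpace N) := spectralSubspace (S.A β) (S.sigmaLow β)

/-- The low-loss/high-Q subspace `H_{ℓℓ,1}(β)`. -/
def Hll1 (β : ℝ) : Submodule ℂ (StateSpace N) := spectralSubspace (S.A β) (S.sigmaMid β)

/-- Modal dichotomy and duality: `H_{ℓℓ,0}(β)` and `H_{ℓℓ,1}(β)` are the unique invariant subspaces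
splitting `H_{ℓℓ}(β)` at `|ζ| = ω_min`; their dimensions are `N_R` and `2N - 2N_R`; the spectra are
symmetric about the imaginary axis and correspond to those of the dual system by `ζ ↦ -ζ⁻¹`. -/
structure ModalDichotomyII (h : S.η.PosDef) (β : ℝ) : Prop where
  splitting : S.IsSplittingII β (S.Hll0 β) (S.Hll1 β)
  unique : ∀ H0 H1, S.IsSplittingII β H0 H1 → H0 = S.Hll0 β ∧ H1 = S.Hll1 β
  finrank_0 : Module.finrank ℂ (S.Hll0 β) = S.R.rank
  finrank_1 : Module.finrank ℂ (S.Hll1 β) = 2 * N - 2 * S.R.rank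
  symm_0 : restrictedSpectrum (S.A β) (S.Hll0 β)
    = (fun ζ => -(starRingEnd ℂ) ζ) '' restrictedSpectrum (S.A β) (S.Hll0 β)
  dual_0 : restrictedSpectrum (S.A β) (S.Hll0 β)
    = (fun ζ => -ζ⁻¹) '' restrictedSpectrum ((S.dual h).A β) ((S.dual h).Hhl β)
  symm_h : restrictedSpectrum (S.A β) (S.Hhl β)
    = (fun ζ => -(starRingEnd ℂ) ζ) '' restrictedSpectrum (S.A β) (S.Hhl β)
  dual_h : restrictedSpectrum (S.A β) (S.Hhl β)
    = (fun ζ => -ζ⁻¹) '' restrictedSpectrum ((S.dual h).A β) ((S.dual h).Hll0 β)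
  symm_1 : restrictedSpectrum (S.A β) (S.Hll1 β)
    = (fun ζ => -(starRingEnd ℂ) ζ) '' restrictedSpectrum (S.A β) (S.Hll1 β)
  dual_1 : restrictedSpectrum (S.A β) (S.Hll1 β)
    = (fun ζ => -ζ⁻¹) '' restrictedSpectrum ((S.dual h).A β) ((S.dual h).Hll1 β)

end LagrangianSystem

end

/-!
The operator `A(β) = Ω - iβB` is `-iβB` perturbed by the Hermitian `Ω`, of norm `ω_max`, so every
eigenvalue lies within `ω_max` of `0` or of some `-iβb`; for `β > 2ω_max / b_min` these two kinds of
discs do not meet. Dimensions are found by an indefinite-form argument instead of a contour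
integral: the form `f x = ‖Px‖² - ‖(1 - P)x‖²`, `P` the projection onto `Ker B`, satisfies
`f (A(β) x) < (β b_min / 2)² f x` for `x ≠ 0`, hence is positive on the low-loss and negative on the
high-loss subspace, and the inertia of `f` bounds both dimensions.

With `J` the swap of the two components, `A(β) J A♭(β) = -J`. So `ζ ↦ -ζ⁻¹` carries the spectrum of
`A(β)` to that of the dual system and exchanges `|ζ| < ω_min` with the high-loss set, which gives
the second splitting.

The compression of `A(β)` to `Ker B` is `PΩP` up to an error that is at most `c(β) < ρ_min / 2` on
the low-loss subspace, so every low-loss eigenvalue is within `c(β)` of an eigenvalue of `PΩP`. A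
second indefinite form, built from the kernel of `PΩP` in `Ker B`, shows that at most `N_R`
eigenvalues satisfy `|ζ| < ρ_min / 2`, and those are already the ones with `|ζ| < ω_min`. The
remaining ones are close to a real `μ` with `|μ| ≥ ρ_min > 2c(β)`, which forces `|Im ζ| < |Re ζ|`.
This property is invariant under `ζ ↦ -ζ⁻¹`, so the same hypothesis on the dual system suffices.
-/
section SpectralSubspace

theorem mem_spectrum_iff_exists_eigenvector {K V : Type*} [Field K] [AddCommGroup V] [Module K V]
    [FiniteDimensional K V] {T : Module.End K V} {ζ : K} :
    ζ ∈ spectrum K T ↔ ∃ w, w ≠ 0 ∧ T w = ζ • w := by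
  rw [← Module.End.hasEigenvalue_iff_mem_spectrum]
  constructor
  · intro h
    obtain ⟨w, hw⟩ := h.exists_hasEigenvector
    exact ⟨w, hw.2, hw.apply_eq_smul⟩
  · rintro ⟨w, hw0, hw⟩
    exact Module.End.hasEigenvalue_of_hasEigenvector ⟨Module.End.mem_eigenspace_iff.2 hw, hw0⟩

variable {V : Type*} [AddCommGroup V] [Module ℂ V] {T : Module.End ℂ V} {s t : Set ℂ}

theorem restrictedSpectrum_subset_spectrum [FiniteDimensional ℂ V] (T : Module.End ℂ V)
    (W : Submodule ℂ V) : restrictedSpectrum T W ⊆ spectrum ℂ T := by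
  rintro ζ ⟨w, -, hw0, hw⟩
  exact mem_spectrum_iff_exists_eigenvector.2 ⟨w, hw0, hw⟩

theorem maxGenEigenspace_le_spectralSubspace {ζ : ℂ} (hζ : ζ ∈ s) :
    T.maxGenEigenspace ζ ≤ spectralSubspace T s :=
  le_biSup T.maxGenEigenspace hζ

theorem mem_spectralSubspace_of_eigenvector {ζ : ℂ} (hζ : ζ ∈ s) {w : V} (hw : T w = ζ • w) :
    w ∈ spectralSubspace T s :=
  maxGenEigenspace_le_spectralSubspace hζ
    (Module.End.eigenspace_le_maxGenEigenspace (Module.End.mem_eigenspace_iff.2 hw))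

theorem apply_mem_spectralSubspace (T : Module.End ℂ V) (s : Set ℂ) :
    ∀ w ∈ spectralSubspace T s, T w ∈ spectralSubspace T s := by
  have hle : spectralSubspace T s ≤ (spectralSubspace T s).comap T :=
    iSup₂_le fun ζ hζ _ hx => maxGenEigenspace_le_spectralSubspace hζ
      (Module.End.mapsTo_maxGenEigenspace_of_comm (Commute.refl T) ζ hx)
  exact fun w hw => hle hw

theorem disjoint_spectralSubspace (T : Module.End ℂ V) (h : Disjoint s t) :
    Disjoint (spectralSubspace T s) (spectralSubspace T t) :=
  T.independent_maxGenEigenspace.disjoint_biSup_biSup h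

theorem spectralSubspace_union (T : Module.End ℂ V) (s t : Set ℂ) :
    spectralSubspace T (s ∪ t) = spectralSubspace T s ⊔ spectralSubspace T t :=
  iSup_union

theorem finrank_spectralSubspace_lt_insert [FiniteDimensional ℂ V] {ζ : ℂ}
    (hζ : ζ ∈ spectrum ℂ T) (hζs : ζ ∉ s) :
    Module.finrank ℂ (spectralSubspace T s)
      < Module.finrank ℂ (spectralSubspace T (insert ζ s)) := by
  obtain ⟨w, hw0, hw⟩ := mem_spectrum_iff_exists_eigenvector.1 hζ
  have hdisj := disjoint_spectralSubspace T (Set.disjoint_singleton_left.2 hζs)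
  rw [Set.insert_eq, spectralSubspace_union]
  refine Submodule.finrank_lt_finrank_of_lt (lt_of_le_not_ge le_sup_right fun hle => hw0 ?_)
  have hwζ := mem_spectralSubspace_of_eigenvector (Set.mem_singleton ζ) hw
  exact Submodule.disjoint_def.1 hdisj w hwζ (hle (Submodule.mem_sup_left hwζ))

theorem restrictedSpectrum_spectralSubspace [FiniteDimensional ℂ V] (hs : s ⊆ spectrum ℂ T) :
    restrictedSpectrum T (spectralSubspace T s) = s := by
  ext ζ
  constructor
  · rintro ⟨w, hws, hw0, hw⟩
    by_contra hζ
    have hdisj := disjoint_spectralSubspace T (Set.disjoint_singleton_right.2 hζ)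
    exact hw0 (Submodule.disjoint_def.1 hdisj w hws
      (mem_spectralSubspace_of_eigenvector (Set.mem_singleton ζ) hw))
  · intro hζ
    obtain ⟨w, hw0, hw⟩ := mem_spectrum_iff_exists_eigenvector.1 (hs hζ)
    exact ⟨w, mem_spectralSubspace_of_eigenvector hζ hw, hw0, hw⟩

theorem le_spectralSubspace [FiniteDimensional ℂ V] {W : Submodule ℂ V}
    (hW : ∀ w ∈ W, T w ∈ W) (hs : restrictedSpectrum T W ⊆ s) : W ≤ spectralSubspace T s := by
  rw [Submodule.eq_iSup_inf_genEigenspace (p := W) (f := T) ⊤ hW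
    (Module.End.iSup_maxGenEigenspace_eq_top T)]
  refine iSup_le fun ζ => ?_
  by_cases hζ : ζ ∈ s
  · exact inf_le_right.trans (maxGenEigenspace_le_spectralSubspace hζ)
  · have hbot : Module.End.genEigenspace (T.restrict hW) ζ ⊤ = ⊥ := by
      by_contra hne
      refine hζ (hs ?_)
      rw [restrictedSpectrum_eq_spectrum T W hW, ← Module.End.hasEigenvalue_iff_mem_spectrum]
      exact Module.End.HasUnifEigenvalue.lt one_pos hne
    rw [Submodule.inf_genEigenspace T W hW, hbot, Submodule.map_bot]
    exact bot_le

theorem spectralSubspace_spectrum [FiniteDimensional ℂ V] (T : Module.End ℂ V) :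
    spectralSubspace T (spectrum ℂ T) = ⊤ :=
  top_le_iff.1 (le_spectralSubspace (fun _ _ => Submodule.mem_top)
    (restrictedSpectrum_subset_spectrum T ⊤))

theorem isCompl_spectralSubspace [FiniteDimensional ℂ V] (hst : Disjoint s t)
    (hunion : spectrum ℂ T = s ∪ t) : IsCompl (spectralSubspace T s) (spectralSubspace T t) :=
  ⟨disjoint_spectralSubspace T hst, codisjoint_iff.2 (by
    rw [← spectralSubspace_union, ← hunion, spectralSubspace_spectrum])⟩

theorem eq_and_eq_of_le_of_le_of_sup_eq {α : Type*} [Lattice α] [IsModularLattice α] [OrderBot α]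
    {a₁ a₂ b₁ b₂ : α} (h₁ : a₁ ≤ b₁) (h₂ : a₂ ≤ b₂) (hb : Disjoint b₁ b₂)
    (hsup : a₁ ⊔ a₂ = b₁ ⊔ b₂) : a₁ = b₁ ∧ a₂ = b₂ := by
  constructor
  · refine eq_of_le_of_inf_le_of_sup_le (z := a₂) h₁ ?_ ?_
    · exact (inf_le_inf_left b₁ h₂).trans (hb.le_bot.trans bot_le)
    · exact (sup_le_sup_left h₂ b₁).trans hsup.ge
  · refine eq_of_le_of_inf_le_of_sup_le (z := a₁) h₂ ?_ ?_
    · exact (inf_le_inf_left b₂ h₁).trans (hb.symm.le_bot.trans bot_le)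
    · rw [sup_comm, sup_comm a₂, hsup]
      exact sup_le_sup_right h₁ b₂

theorem eq_spectralSubspace_of_sup_eq [FiniteDimensional ℂ V] {W₁ W₂ : Submodule ℂ V}
    (hW₁ : ∀ w ∈ W₁, T w ∈ W₁) (hW₂ : ∀ w ∈ W₂, T w ∈ W₂) (hs : restrictedSpectrum T W₁ = s)
    (ht : restrictedSpectrum T W₂ = t) (hst : Disjoint s t)
    (hsup : W₁ ⊔ W₂ = spectralSubspace T s ⊔ spectralSubspace T t) :
    W₁ = spectralSubspace T s ∧ W₂ = spectralSubspace T t :=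
  eq_and_eq_of_le_of_le_of_sup_eq (le_spectralSubspace hW₁ hs.subset)
    (le_spectralSubspace hW₂ ht.subset) (disjoint_spectralSubspace T hst) hsup

end SpectralSubspace

section SpectralTransfer

variable {V V' : Type*} [AddCommGroup V] [Module ℂ V] [AddCommGroup V'] [Module ℂ V']
  {T : Module.End ℂ V} {T' : Module.End ℂ V'} {e : V ≃ₗ[ℂ] V'}

theorem neg_conj_mem_spectrum_of_anticommute [FiniteDimensional ℂ V] {J : V →ₛₗ[starRingEnd ℂ] V}
    (hJ : Function.Injective J) (hTJ : ∀ x, T (J x) = -J (T x)) {ζ : ℂ} (hζ : ζ ∈ spectrum ℂ T) :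
    -(starRingEnd ℂ) ζ ∈ spectrum ℂ T := by
  obtain ⟨w, hw0, hw⟩ := mem_spectrum_iff_exists_eigenvector.1 hζ
  refine mem_spectrum_iff_exists_eigenvector.2 ⟨J w, (map_ne_zero_iff J hJ).2 hw0, ?_⟩
  rw [hTJ, hw, LinearMap.map_smulₛₗ, neg_smul]

theorem neg_inv_neg_inv {K : Type*} [DivisionRing K] (ζ : K) : -(-ζ⁻¹)⁻¹ = ζ := by
  rw [inv_neg, inv_inv, neg_neg]

theorem ne_zero_and_apply_eq_of_reciprocal (he : ∀ x, T' (e (T x)) = -e x) {w : V}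
    (hw0 : w ≠ 0) {ζ : ℂ} (hw : T w = ζ • w) : ζ ≠ 0 ∧ T' (e w) = (-ζ⁻¹) • e w := by
  have hsmul : ζ • T' (e w) = -e w := by rw [← map_smul, ← map_smul, ← hw, he]
  have hζ : ζ ≠ 0 := by
    rintro rfl
    rw [zero_smul, zero_eq_neg, e.map_eq_zero_iff] at hsmul
    exact hw0 hsmul
  refine ⟨hζ, ?_⟩
  rw [← inv_smul_smul₀ hζ (T' (e w)), hsmul, smul_neg, neg_smul]

variable [FiniteDimensional ℂ V]

theorem zero_notMem_spectrum_of_reciprocal (he : ∀ x, T' (e (T x)) = -e x) :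
    0 ∉ spectrum ℂ T := by
  intro hmem
  obtain ⟨w, hw0, hw⟩ := mem_spectrum_iff_exists_eigenvector.1 hmem
  exact (ne_zero_and_apply_eq_of_reciprocal he hw0 hw).1 rfl

theorem reciprocal_symm (he : ∀ x, T' (e (T x)) = -e x) (y : V') :
    T (e.symm (T' y)) = -e.symm y := by
  have hleft : (-(e.symm.toLinearMap ∘ₗ T' ∘ₗ e.toLinearMap) : Module.End ℂ V) * T = 1 := by
    ext x
    simp [he]
  have hright := DFunLike.congr_fun (mul_eq_one_comm.1 hleft) (e.symm y)
  simpa [neg_eq_iff_eq_neg] using hright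

variable [FiniteDimensional ℂ V']

theorem neg_inv_mem_spectrum_of_reciprocal (he : ∀ x, T' (e (T x)) = -e x) {ζ : ℂ}
    (hζ : ζ ∈ spectrum ℂ T) : -ζ⁻¹ ∈ spectrum ℂ T' := by
  obtain ⟨w, hw0, hw⟩ := mem_spectrum_iff_exists_eigenvector.1 hζ
  exact mem_spectrum_iff_exists_eigenvector.2
    ⟨e w, e.map_ne_zero_iff.2 hw0, (ne_zero_and_apply_eq_of_reciprocal he hw0 hw).2⟩

theorem map_spectralSubspace_le_of_reciprocal (he : ∀ x, T' (e (T x)) = -e x) {s : Set ℂ}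
    (hs : s ⊆ spectrum ℂ T) : (spectralSubspace T s).map e.toLinearMap
      ≤ spectralSubspace T' ((fun ζ => -ζ⁻¹) '' s) := by
  have hinj : Function.Injective T := fun x y hxy =>
    e.injective (neg_injective (by rw [← he, hxy, he]))
  have hmap : (spectralSubspace T s).map T = spectralSubspace T s :=
    Submodule.eq_of_le_of_finrank_eq
      (Submodule.map_le_iff_le_comap.2 (apply_mem_spectralSubspace T s))
      (Submodule.equivMapOfInjective T hinj _).finrank_eq.symm
  apply le_spectralSubspace
  · rintro _ ⟨y, hy, rfl⟩
    rw [← hmap] at hy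
    obtain ⟨z, hz, rfl⟩ := hy
    rw [LinearEquiv.coe_coe, he]
    exact Submodule.neg_mem _ ⟨z, hz, rfl⟩
  · rintro ζ ⟨_, ⟨y, hy, rfl⟩, hy0, hζ⟩
    have heigen := (ne_zero_and_apply_eq_of_reciprocal (reciprocal_symm he) hy0 hζ).2
    rw [LinearEquiv.coe_coe, e.symm_apply_apply] at heigen
    have hmem : -ζ⁻¹ ∈ restrictedSpectrum T (spectralSubspace T s) :=
      ⟨y, hy, e.map_ne_zero_iff.1 hy0, heigen⟩
    rw [restrictedSpectrum_spectralSubspace hs] at hmem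
    exact ⟨-ζ⁻¹, hmem, neg_inv_neg_inv ζ⟩

theorem finrank_spectralSubspace_of_reciprocal (he : ∀ x, T' (e (T x)) = -e x) {s : Set ℂ}
    (hs : s ⊆ spectrum ℂ T) : Module.finrank ℂ (spectralSubspace T s)
      = Module.finrank ℂ (spectralSubspace T' ((fun ζ => -ζ⁻¹) '' s)) := by
  apply le_antisymm
  · rw [← LinearEquiv.finrank_map_eq e (spectralSubspace T s)]
    exact Submodule.finrank_mono (map_spectralSubspace_le_of_reciprocal he hs)
  · have himage : (fun ζ => -ζ⁻¹) '' s ⊆ spectrum ℂ T' :=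
      Set.image_subset_iff.2 fun ζ hζ => neg_inv_mem_spectrum_of_reciprocal he (hs hζ)
    have hle := map_spectralSubspace_le_of_reciprocal (reciprocal_symm he) himage
    simp only [Set.image_image, neg_inv_neg_inv, Set.image_id'] at hle
    rw [← LinearEquiv.finrank_map_eq e.symm]
    exact Submodule.finrank_mono hle

theorem spectrum_inter_eq_image_of_reciprocal (he : ∀ x, T' (e (T x)) = -e x) {s : Set ℂ} :
    spectrum ℂ T' ∩ {ζ | -ζ⁻¹ ∈ s} = (fun ζ => -ζ⁻¹) '' (spectrum ℂ T ∩ s) := by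
  apply Set.Subset.antisymm
  · rintro ζ ⟨hζ, hs⟩
    exact ⟨-ζ⁻¹, ⟨neg_inv_mem_spectrum_of_reciprocal (reciprocal_symm he) hζ, hs⟩,
      neg_inv_neg_inv ζ⟩
  · rintro _ ⟨ζ, ⟨hζ, hs⟩, rfl⟩
    exact ⟨neg_inv_mem_spectrum_of_reciprocal he hζ, by simpa [neg_inv_neg_inv] using hs⟩

end SpectralTransfer

section Lyapunov

open Filter Topology

theorem tendsto_pow_zero_of_spectralRadius_lt_one {𝓐 : Type*} [NormedRing 𝓐] [NormedAlgebra ℂ 𝓐]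
    [CompleteSpace 𝓐] {a : 𝓐} (ha : spectralRadius ℂ a < 1) :
    Tendsto (fun n : ℕ => a ^ n) atTop (𝓝 0) := by
  obtain ⟨r, har, hr1⟩ := ENNReal.lt_iff_exists_nnreal_btwn.1 ha
  have hroot := spectrum.pow_nnnorm_pow_one_div_tendsto_nhds_spectralRadius a
  have hbound : ∀ᶠ n : ℕ in atTop, ‖a ^ n‖ ≤ (r : ℝ) ^ n := by
    filter_upwards [hroot.eventually_lt_const har, eventually_gt_atTop 0] with n hn hn0
    have hpow : ((‖a ^ n‖₊ : ENNReal) ^ (1 / n : ℝ)) ^ n ≤ (r : ENNReal) ^ n :=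
      pow_le_pow_left' hn.le n
    rw [← ENNReal.rpow_natCast, ← ENNReal.rpow_mul,
      one_div_mul_cancel (by exact_mod_cast hn0.ne'), ENNReal.rpow_one] at hpow
    exact_mod_cast hpow
  exact squeeze_zero_norm' hbound
    (tendsto_pow_atTop_nhds_zero_of_lt_one r.coe_nonneg (by exact_mod_cast hr1))

theorem lt_of_forall_apply_lt_of_tendsto_iterate {X Y : Type*} [TopologicalSpace X]
    [TopologicalSpace Y] [Preorder Y] [OrderClosedTopology Y] {g : X → X} {f : X → Y} {x₀ : X}
    (hf : ContinuousAt f x₀) (hfix : g x₀ = x₀) (hlt : ∀ x, x ≠ x₀ → f (g x) < f x)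
    (hg : ∀ x, Tendsto (fun n => g^[n] x) atTop (𝓝 x₀)) {x : X} (hx : x ≠ x₀) :
    f x₀ < f x := by
  have hle : ∀ y, f (g y) ≤ f y := fun y => by
    rcases eq_or_ne y x₀ with rfl | hy
    · rw [hfix]
    · exact (hlt y hy).le
  have hanti : Antitone fun n => f (g^[n] (g x)) := antitone_nat_of_succ_le fun n => by
    rw [Function.iterate_succ_apply']
    exact hle _
  exact (hanti.le_of_tendsto (hf.tendsto.comp (hg (g x))) 0).trans_lt (hlt x hx)

variable {V : Type*} [NormedAddCommGroup V] [NormedSpace ℂ V] {T : Module.End ℂ V} {f : V → ℝ}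
  {W : Submodule ℂ V} {s : ℝ}

theorem scaled_apply_lt (hW : ∀ w ∈ W, T w ∈ W) (hs : 0 < s)
    (hhom : ∀ (c : ℂ) x, f (c • x) = ‖c‖ ^ 2 * f x)
    (hlt : ∀ x ∈ W, x ≠ 0 → f (T x) < s ^ 2 * f x) {w : W} (hw : w ≠ 0) :
    f (((s : ℂ)⁻¹ • T.restrict hW : Module.End ℂ W) w) < f w := by
  change f ((s : ℂ)⁻¹ • T w) < f w
  rw [hhom, norm_inv, Complex.norm_real, Real.norm_of_nonneg hs.le, inv_pow,
    inv_mul_lt_iff₀ (by positivity)]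
  exact hlt w w.2 (by simpa using hw)

variable [FiniteDimensional ℂ V]

theorem tendsto_pow_apply_zero (hT : ∀ ζ ∈ spectrum ℂ T, ‖ζ‖ < 1) (x : V) :
    Tendsto (fun n : ℕ => (T ^ n) x) atTop (𝓝 0) := by
  rcases subsingleton_or_nontrivial V with hV | hV
  · exact tendsto_const_nhds.congr fun n => Subsingleton.elim _ _
  have : CompleteSpace V := FiniteDimensional.complete ℂ V
  let e : Module.End ℂ V ≃ₐ[ℂ] (V →L[ℂ] V) := Module.End.toContinuousLinearMap V
  have hradius : spectralRadius ℂ (e T) < (1 : NNReal) :=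
    spectrum.spectralRadius_lt_of_forall_lt _ fun z hz => by
      rw [AlgEquiv.spectrum_eq] at hz
      exact_mod_cast hT z hz
  have hpow := tendsto_pow_zero_of_spectralRadius_lt_one hradius
  have happly := ((ContinuousLinearMap.apply ℂ V x).continuous.tendsto 0).comp hpow
  refine happly.congr fun n => ?_
  change (e T ^ n) x = _
  rw [← map_pow]
  rfl

theorem pos_of_apply_lt_of_spectrum_lt_one (hT : ∀ ζ ∈ spectrum ℂ T, ‖ζ‖ < 1) (hf : Continuous f)
    (hf0 : f 0 = 0) (hlt : ∀ x, x ≠ 0 → f (T x) < f x) {x : V} (hx : x ≠ 0) : 0 < f x := by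
  rw [← hf0]
  refine lt_of_forall_apply_lt_of_tendsto_iterate hf.continuousAt (map_zero T) hlt
    (fun y => ?_) hx
  simpa only [Module.End.pow_apply] using tendsto_pow_apply_zero hT y

theorem neg_of_apply_lt_of_one_lt_spectrum (hT : ∀ ζ ∈ spectrum ℂ T, 1 < ‖ζ‖) (hf : Continuous f)
    (hf0 : f 0 = 0) (hlt : ∀ x, x ≠ 0 → f (T x) < f x) {x : V} (hx : x ≠ 0) : f x < 0 := by
  have hzero : (0 : ℂ) ∉ spectrum ℂ T := fun hmem => by
    have := hT 0 hmem
    rw [norm_zero] at this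
    exact zero_lt_one.not_gt this
  obtain ⟨u, rfl⟩ : IsUnit T := spectrum.zero_notMem_iff ℂ |>.1 hzero
  have hinv : ∀ ζ ∈ spectrum ℂ (↑u⁻¹ : Module.End ℂ V), ‖ζ‖ < 1 := fun ζ hζ => by
    have hζ0 : ζ ≠ 0 := spectrum.ne_zero_of_mem_of_unit hζ
    have hbound := hT ζ⁻¹ (spectrum.inv₀_mem_iff.2 hζ)
    rw [norm_inv] at hbound
    exact (one_lt_inv₀ (norm_pos_iff.2 hζ0)).1 hbound
  have hu : ∀ y, (u : Module.End ℂ V) ((↑u⁻¹ : Module.End ℂ V) y) = y := fun y => by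
    rw [← Module.End.mul_apply, u.mul_inv, Module.End.one_apply]
  refine neg_pos.1 (pos_of_apply_lt_of_spectrum_lt_one (f := fun y => -f y) hinv hf.neg
    (by rw [hf0, neg_zero]) (fun y hy => neg_lt_neg ?_) hx)
  have hlt' := hlt ((↑u⁻¹ : Module.End ℂ V) y) fun h0 => hy (by rw [← hu y, h0, map_zero])
  rwa [hu] at hlt'

theorem mul_mem_restrictedSpectrum (hW : ∀ w ∈ W, T w ∈ W) {c ζ : ℂ} (hc : c ≠ 0)
    (hζ : ζ ∈ spectrum ℂ (c⁻¹ • T.restrict hW : Module.End ℂ W)) :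
    c * ζ ∈ restrictedSpectrum T W := by
  obtain ⟨w, hw0, hw⟩ := mem_spectrum_iff_exists_eigenvector.1 hζ
  refine ⟨w, w.2, by simpa using hw0, ?_⟩
  have hw' : c⁻¹ • T w = ζ • (w : V) := congrArg Subtype.val hw
  rw [mul_smul, ← hw', smul_inv_smul₀ hc]

theorem pos_of_restrictedSpectrum_lt (hW : ∀ w ∈ W, T w ∈ W) (hs : 0 < s)
    (hspec : ∀ ζ ∈ restrictedSpectrum T W, ‖ζ‖ < s) (hf : Continuous f)
    (hhom : ∀ (c : ℂ) x, f (c • x) = ‖c‖ ^ 2 * f x)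
    (hlt : ∀ x ∈ W, x ≠ 0 → f (T x) < s ^ 2 * f x) {x : V} (hxW : x ∈ W) (hx : x ≠ 0) :
    0 < f x := by
  refine pos_of_apply_lt_of_spectrum_lt_one (T := (s : ℂ)⁻¹ • T.restrict hW) (f := fun w : W => f w)
    (fun ζ hζ => ?_) (hf.comp continuous_subtype_val) (by simpa using hhom 0 0)
    (fun w hw => scaled_apply_lt hW hs hhom hlt hw) (x := ⟨x, hxW⟩) (by simpa using hx)
  have hbound := hspec _ (mul_mem_restrictedSpectrum hW (by exact_mod_cast hs.ne') hζ)
  rw [norm_mul, Complex.norm_real, Real.norm_of_nonneg hs.le] at hbound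
  exact lt_of_mul_lt_mul_left (by rwa [mul_one]) hs.le

theorem neg_of_lt_restrictedSpectrum (hW : ∀ w ∈ W, T w ∈ W) (hs : 0 < s)
    (hspec : ∀ ζ ∈ restrictedSpectrum T W, s < ‖ζ‖) (hf : Continuous f)
    (hhom : ∀ (c : ℂ) x, f (c • x) = ‖c‖ ^ 2 * f x)
    (hlt : ∀ x ∈ W, x ≠ 0 → f (T x) < s ^ 2 * f x) {x : V} (hxW : x ∈ W) (hx : x ≠ 0) :
    f x < 0 := by
  refine neg_of_apply_lt_of_one_lt_spectrum (T := (s : ℂ)⁻¹ • T.restrict hW) (f := fun w : W => f w)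
    (fun ζ hζ => ?_) (hf.comp continuous_subtype_val) (by simpa using hhom 0 0)
    (fun w hw => scaled_apply_lt hW hs hhom hlt hw) (x := ⟨x, hxW⟩) (by simpa using hx)
  have hbound := hspec _ (mul_mem_restrictedSpectrum hW (by exact_mod_cast hs.ne') hζ)
  rw [norm_mul, Complex.norm_real, Real.norm_of_nonneg hs.le] at hbound
  exact lt_of_mul_lt_mul_left (by rwa [mul_one]) hs.le

end Lyapunov

section SymmetricOperator

variable {𝕜 E : Type*} [RCLike 𝕜] [NormedAddCommGroup E] [InnerProductSpace 𝕜 E]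
  {T : E →ₗ[𝕜] E}

theorem apply_mem_orthogonal_ker_of_isSymmetric (hT : T.IsSymmetric) (x : E) :
    T x ∈ (LinearMap.ker T)ᗮ := fun y hy => by
  rw [← hT y x, LinearMap.mem_ker.1 hy, inner_zero_left]

variable [FiniteDimensional 𝕜 E]

theorem norm_smul_apply_sub_smul_sq (hT : T.IsSymmetric) (κ ζ : 𝕜) (x : E) :
    ‖κ • T x - ζ • x‖ ^ 2 = ∑ i, ‖κ * (hT.eigenvalues rfl i : 𝕜) - ζ‖ ^ 2
      * ‖(hT.eigenvectorBasis rfl).repr x i‖ ^ 2 := by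
  rw [← (hT.eigenvectorBasis rfl).repr.norm_map, EuclideanSpace.norm_sq_eq]
  refine Finset.sum_congr rfl fun i _ => ?_
  rw [map_sub, map_smul, map_smul, PiLp.sub_apply, PiLp.smul_apply, PiLp.smul_apply,
    hT.eigenvectorBasis_apply_self_apply, smul_eq_mul, smul_eq_mul, ← mul_pow, ← norm_mul, sub_mul,
    mul_assoc]

theorem norm_apply_sq (hT : T.IsSymmetric) (x : E) :
    ‖T x‖ ^ 2 = ∑ i, |hT.eigenvalues rfl i| ^ 2
      * ‖(hT.eigenvectorBasis rfl).repr x i‖ ^ 2 := by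
  simpa using norm_smul_apply_sub_smul_sq hT 1 0 x

theorem norm_sq_eq_sum_eigenvectorBasis (hT : T.IsSymmetric) (x : E) :
    ‖x‖ ^ 2 = ∑ i, ‖(hT.eigenvectorBasis rfl).repr x i‖ ^ 2 := by
  rw [← EuclideanSpace.norm_sq_eq, LinearIsometryEquiv.norm_map]

theorem eigenvalues_mem_spectrum (hT : T.IsSymmetric) (i : Fin (Module.finrank 𝕜 E)) :
    ((hT.eigenvalues rfl i : ℝ) : 𝕜) ∈ spectrum 𝕜 (T : Module.End 𝕜 E) :=
  Module.End.hasEigenvalue_iff_mem_spectrum.1 (hT.hasEigenvalue_eigenvalues rfl i)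

theorem exists_ofReal_eq_of_mem_spectrum (hT : T.IsSymmetric) {ζ : 𝕜}
    (hζ : ζ ∈ spectrum 𝕜 (T : Module.End 𝕜 E)) : ∃ μ : ℝ, (μ : 𝕜) = ζ :=
  ⟨_, RCLike.conj_eq_iff_re.1
    (hT.conj_eigenvalue_eq_self (Module.End.hasEigenvalue_iff_mem_spectrum.2 hζ))⟩

theorem exists_eigenvalue_norm_sub_le (hT : T.IsSymmetric) {κ ζ : 𝕜} {c : ℝ} {x : E} (hx : x ≠ 0)
    (h : ‖κ • T x - ζ • x‖ ≤ c * ‖x‖) :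
    ∃ μ : ℝ, (μ : 𝕜) ∈ spectrum 𝕜 (T : Module.End 𝕜 E) ∧ ‖κ * μ - ζ‖ ≤ c := by
  by_contra! hfar
  have hc : 0 ≤ c := nonneg_of_mul_nonneg_left ((norm_nonneg _).trans h) (norm_pos_iff.2 hx)
  have hfar' : ∀ i, c < ‖κ * (hT.eigenvalues rfl i : 𝕜) - ζ‖ := fun i =>
    hfar _ (eigenvalues_mem_spectrum hT i)
  obtain ⟨j, hj⟩ : ∃ j, (hT.eigenvectorBasis rfl).repr x j ≠ 0 := by
    by_contra! hzero
    exact hx ((hT.eigenvectorBasis rfl).repr.map_eq_zero_iff.1 (by ext i; simpa using hzero i))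
  have hlt : (c * ‖x‖) ^ 2 < ‖κ • T x - ζ • x‖ ^ 2 := by
    rw [norm_smul_apply_sub_smul_sq hT, mul_pow, norm_sq_eq_sum_eigenvectorBasis hT,
      Finset.mul_sum]
    refine Finset.sum_lt_sum (fun i _ => ?_) ⟨j, Finset.mem_univ j, ?_⟩
    · have := (hfar' i).le
      gcongr
    · have := hfar' j
      have := norm_pos_iff.2 hj
      gcongr
  exact hlt.not_ge (pow_le_pow_left₀ (norm_nonneg _) h 2)

theorem norm_apply_le_of_spectrum (hT : T.IsSymmetric) {ω : ℝ} (hω0 : 0 ≤ ω)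
    (hω : ∀ μ : ℝ, (μ : 𝕜) ∈ spectrum 𝕜 (T : Module.End 𝕜 E) → |μ| ≤ ω) (x : E) :
    ‖T x‖ ≤ ω * ‖x‖ := by
  refine le_of_sq_le_sq ?_ (by positivity)
  rw [norm_apply_sq hT, mul_pow, norm_sq_eq_sum_eigenvectorBasis hT, Finset.mul_sum]
  refine Finset.sum_le_sum fun i _ => ?_
  have := hω _ (eigenvalues_mem_spectrum hT i)
  gcongr

theorem mul_norm_le_norm_apply_of_spectrum (hT : T.IsSymmetric) {ρ : ℝ} (hρ0 : 0 ≤ ρ)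
    (hρ : ∀ μ : ℝ, (μ : 𝕜) ∈ spectrum 𝕜 (T : Module.End 𝕜 E) → μ ≠ 0 → ρ ≤ |μ|) {x : E}
    (hx : x ∈ (LinearMap.ker T)ᗮ) : ρ * ‖x‖ ≤ ‖T x‖ := by
  refine le_of_sq_le_sq ?_ (norm_nonneg _)
  rw [norm_apply_sq hT, mul_pow, norm_sq_eq_sum_eigenvectorBasis hT, Finset.mul_sum]
  refine Finset.sum_le_sum fun i _ => ?_
  rcases eq_or_ne (hT.eigenvalues rfl i) 0 with hzero | hne
  · have hrepr : (hT.eigenvectorBasis rfl).repr x i = 0 := by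
      rw [OrthonormalBasis.repr_apply_apply]
      refine hx _ ?_
      rw [LinearMap.mem_ker, hT.apply_eigenvectorBasis, hzero, RCLike.ofReal_zero, zero_smul]
    rw [hrepr, norm_zero, zero_pow two_ne_zero, mul_zero, mul_zero]
  · have := hρ _ (eigenvalues_mem_spectrum hT i) hne
    gcongr

end SymmetricOperator

section ProjectionForm

variable {𝕜 E : Type*} [RCLike 𝕜] [NormedAddCommGroup E] [InnerProductSpace 𝕜 E]

/-- The indefinite form `‖P x‖² - ‖(1 - P) x‖²` for the orthogonal projection `P` onto `U`. It is
the Lyapunov function that counts eigenvalues: a subspace on which it is positive has dimension at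
most `dim U`. -/
noncomputable def projectionForm (U : Submodule 𝕜 E) [U.HasOrthogonalProjection] (x : E) : ℝ :=
  ‖U.starProjection x‖ ^ 2 - ‖Uᗮ.starProjection x‖ ^ 2

section General

variable (U : Submodule 𝕜 E) [U.HasOrthogonalProjection]

theorem continuous_projectionForm : Continuous (projectionForm U) := by
  unfold projectionForm
  fun_prop

theorem projectionForm_smul (c : 𝕜) (x : E) :
    projectionForm U (c • x) = ‖c‖ ^ 2 * projectionForm U x := by
  simp only [projectionForm, map_smul, norm_smul]
  ring

variable {U}

theorem projectionForm_nonpos_of_mem_orthogonal {x : E} (hx : x ∈ Uᗮ) :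
    projectionForm U x ≤ 0 := by
  rw [projectionForm, (Submodule.starProjection_apply_eq_zero_iff _).2 hx, norm_zero,
    zero_pow two_ne_zero, zero_sub]
  exact neg_nonpos.2 (sq_nonneg _)

theorem projectionForm_nonneg_of_mem {x : E} (hx : x ∈ U) : 0 ≤ projectionForm U x := by
  rw [projectionForm, (Submodule.starProjection_apply_eq_zero_iff _).2
    (Submodule.le_orthogonal_orthogonal _ hx), norm_zero, zero_pow two_ne_zero, sub_zero]
  exact sq_nonneg _

variable [FiniteDimensional 𝕜 E] {W : Submodule 𝕜 E}

theorem finrank_le_of_disjoint_orthogonal {U W : Submodule 𝕜 E} (h : Disjoint W Uᗮ) :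
    Module.finrank 𝕜 W ≤ Module.finrank 𝕜 U := by
  have hle := Submodule.finrank_add_finrank_le_of_disjoint h
  rw [← Submodule.finrank_add_finrank_orthogonal U] at hle
  exact Nat.le_of_add_le_add_right hle

theorem finrank_le_of_projectionForm_pos (hW : ∀ x ∈ W, x ≠ 0 → 0 < projectionForm U x) :
    Module.finrank 𝕜 W ≤ Module.finrank 𝕜 U :=
  finrank_le_of_disjoint_orthogonal <| Submodule.disjoint_def.2 fun x hx hxU => by
    by_contra hx0
    exact (hW x hx hx0).not_ge (projectionForm_nonpos_of_mem_orthogonal hxU)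

theorem finrank_le_of_projectionForm_neg (hW : ∀ x ∈ W, x ≠ 0 → projectionForm U x < 0) :
    Module.finrank 𝕜 W ≤ Module.finrank 𝕜 Uᗮ :=
  finrank_le_of_disjoint_orthogonal <| Submodule.disjoint_def.2 fun x hx hxU => by
    by_contra hx0
    rw [Submodule.orthogonal_orthogonal] at hxU
    exact (hW x hx hx0).not_ge (projectionForm_nonneg_of_mem hxU)

end General

section Perturbation

variable [FiniteDimensional 𝕜 E] {T : E →ₗ[𝕜] E} (hT : ∀ x, T x ∈ (LinearMap.ker T)ᗮ)
include hT

theorem starProjection_ker_apply_add (x z : E) : (LinearMap.ker T).starProjection (T x + z)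
    = (LinearMap.ker T).starProjection z := by
  rw [map_add, (Submodule.starProjection_apply_eq_zero_iff _).2 (hT x), zero_add]

theorem mul_norm_starProjection_orthogonal_ker_le {τ : ℝ}
    (hτ : ∀ u ∈ (LinearMap.ker T)ᗮ, τ * ‖u‖ ≤ ‖T u‖) (x z : E) :
    τ * ‖(LinearMap.ker T)ᗮ.starProjection x‖ ≤ ‖(LinearMap.ker T)ᗮ.starProjection (T x + z)‖
      + ‖(LinearMap.ker T)ᗮ.starProjection z‖ := by
  have happly : T ((LinearMap.ker T)ᗮ.starProjection x) = T x := by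
    conv_rhs => rw [← (LinearMap.ker T).starProjection_add_starProjection_orthogonal x, map_add,
      LinearMap.mem_ker.1 ((LinearMap.ker T).starProjection_apply_mem x), zero_add]
  refine (hτ _ (Submodule.starProjection_apply_mem _ x)).trans ?_
  rw [happly, map_add, Submodule.starProjection_eq_self_iff.2 (hT x)]
  simpa only [add_sub_cancel_right] using norm_sub_le (T x + (LinearMap.ker T)ᗮ.starProjection z)
    ((LinearMap.ker T)ᗮ.starProjection z)

theorem projectionForm_ker_apply_add_lt {s : ℝ} (hs : 0 ≤ s)
    (hlow : ∀ u ∈ (LinearMap.ker T)ᗮ, 2 * s * ‖u‖ ≤ ‖T u‖) {x z : E} (hz : ‖z‖ < s * ‖x‖) :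
    projectionForm (LinearMap.ker T) (T x + z)
      < s ^ 2 * projectionForm (LinearMap.ker T) x := by
  have hsq : ‖z‖ ^ 2 < s ^ 2 * ‖x‖ ^ 2 := by
    rw [← mul_pow]
    exact pow_lt_pow_left₀ hz (norm_nonneg z) two_ne_zero
  rw [Submodule.norm_sq_eq_add_norm_sq_starProjection z (LinearMap.ker T),
    Submodule.norm_sq_eq_add_norm_sq_starProjection x (LinearMap.ker T)] at hsq
  have hgrow := pow_le_pow_left₀ (by positivity)
    (mul_norm_starProjection_orthogonal_ker_le hT hlow x z) 2
  rw [projectionForm, projectionForm, starProjection_ker_apply_add hT]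
  nlinarith [sq_nonneg (‖(LinearMap.ker T)ᗮ.starProjection (T x + z)‖
    - ‖(LinearMap.ker T)ᗮ.starProjection z‖)]

theorem mul_norm_le_of_projectionForm_nonneg {τ ω : ℝ} (hω : 0 ≤ ω)
    (hlow : ∀ u ∈ (LinearMap.ker T)ᗮ, τ * ‖u‖ ≤ ‖T u‖) {x z : E} (hz : ‖z‖ ≤ ω * ‖x‖)
    (hform : 0 ≤ projectionForm (LinearMap.ker T) (T x + z)) :
    (τ - 2 * ω) * ‖(LinearMap.ker T)ᗮ.starProjection x‖
      ≤ 2 * ω * ‖(LinearMap.ker T).starProjection x‖ := by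
  have hmain := mul_norm_starProjection_orthogonal_ker_le hT hlow x z
  rw [projectionForm, sub_nonneg, starProjection_ker_apply_add hT,
    sq_le_sq₀ (norm_nonneg _) (norm_nonneg _)] at hform
  have hker := (LinearMap.ker T).norm_starProjection_apply_le z
  have horth := (LinearMap.ker T)ᗮ.norm_starProjection_apply_le z
  have hx : ω * ‖x‖ ≤ ω * (‖(LinearMap.ker T).starProjection x‖
      + ‖(LinearMap.ker T)ᗮ.starProjection x‖) := by
    gcongr
    conv_lhs => rw [← (LinearMap.ker T).starProjection_add_starProjection_orthogonal x]
    exact norm_add_le _ _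
  linarith

end Perturbation

end ProjectionForm

section Matrices

variable {n : Type*} [Fintype n]

theorem rank_mul_mul_of_isUnit_det [DecidableEq n] {K : Type*} [CommRing K] {P Q : Matrix n n K}
    (hP : IsUnit P.det) (hQ : IsUnit Q.det) (M : Matrix n n K) : (P * M * Q).rank = M.rank := by
  rw [Matrix.rank_mul_eq_left_of_isUnit_det _ _ hQ, Matrix.rank_mul_eq_right_of_isUnit_det _ _ hP]

theorem rank_map_ringHom {K L : Type*} [Field K] [Field L] (f : K →+* L) (M : Matrix n n K) :
    (M.map f).rank = M.rank := by
  classical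
  obtain ⟨l, l', D, hD⟩ := Matrix.Pivot.exists_list_transvec_mul_mul_list_transvec_eq_diagonal M
  set P := (l.map Matrix.TransvectionStruct.toMatrix).prod
  set Q := (l'.map Matrix.TransvectionStruct.toMatrix).prod
  have hP : IsUnit P.det := by simp [P, Matrix.TransvectionStruct.det_toMatrix_prod]
  have hQ : IsUnit Q.det := by simp [Q, Matrix.TransvectionStruct.det_toMatrix_prod]
  have isUnit_det_map {X : Matrix n n K} (hX : IsUnit X.det) : IsUnit (X.map f).det := by
    simpa only [f.map_det, RingHom.mapMatrix_apply] using hX.map f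
  have hfD : P.map f * M.map f * Q.map f = Matrix.diagonal (fun i => f (D i)) := by
    rw [← Matrix.map_mul, ← Matrix.map_mul, hD, Matrix.diagonal_map (map_zero f)]
  rw [← rank_mul_mul_of_isUnit_det hP hQ M, hD,
    ← rank_mul_mul_of_isUnit_det (isUnit_det_map hP) (isUnit_det_map hQ), hfD,
    Matrix.rank_diagonal, Matrix.rank_diagonal]
  simp only [ne_eq, map_eq_zero]

theorem rank_fromBlocks_zero {K m l k : Type*} [Field K] [Finite m] [Finite l] [Fintype k]
    (M : Matrix m n K) :
    (Matrix.fromBlocks M 0 0 0 : Matrix (m ⊕ l) (n ⊕ k) K).rank = M.rank := by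
  classical
  cases nonempty_fintype m
  cases nonempty_fintype l
  have hext : (Matrix.fromBlocks M 0 0 0 : Matrix (m ⊕ l) (n ⊕ k) K)
      = Matrix.fromRows (1 : Matrix m m K) 0 * M * Matrix.fromCols (1 : Matrix n n K) 0 := by
    rw [Matrix.fromRows_mul, Matrix.fromRows_mul_fromCols]
    simp only [Matrix.one_mul, Matrix.mul_one, Matrix.mul_zero, Matrix.zero_mul]
  have hcompr : M = Matrix.fromCols (1 : Matrix m m K) (0 : Matrix m l K)
      * (Matrix.fromBlocks M 0 0 0 : Matrix (m ⊕ l) (n ⊕ k) K)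
      * Matrix.fromRows (1 : Matrix n n K) (0 : Matrix k n K) := by
    rw [Matrix.fromCols_mul_fromBlocks, Matrix.fromCols_mul_fromRows]
    simp only [Matrix.one_mul, Matrix.mul_one, Matrix.mul_zero, add_zero]
  apply le_antisymm
  · rw [hext]
    exact (Matrix.rank_mul_le_left _ _).trans (Matrix.rank_mul_le_right _ _)
  · conv_lhs => rw [hcompr]
    exact (Matrix.rank_mul_le_left _ _).trans (Matrix.rank_mul_le_right _ _)

theorem map_ofReal_mul {m n l : Type*} [Fintype n] (M : Matrix m n ℝ) (M' : Matrix n l ℝ) :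
    (M * M').map Complex.ofReal = M.map Complex.ofReal * M'.map Complex.ofReal :=
  Matrix.map_mul (f := Complex.ofRealHom)

theorem conjTranspose_map_ofReal {m l : Type*} (M : Matrix m l ℝ) :
    (M.map Complex.ofReal).conjTranspose = M.transpose.map Complex.ofReal := by
  ext i j
  simp

theorem transpose_sqrt [DecidableEq n] (M : Matrix n n ℝ) : (CFC.sqrt M).transpose = CFC.sqrt M :=
  (Matrix.nonneg_iff_posSemidef.1 (CFC.sqrt_nonneg M)).isHermitian

theorem isUnit_det_sqrt [DecidableEq n] {M : Matrix n n ℝ} (hM : M.PosDef) :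
    IsUnit (CFC.sqrt M).det := by
  rw [← Matrix.isUnit_iff_isUnit_det,
    CFC.isUnit_sqrt_iff M (Matrix.nonneg_iff_posSemidef.2 hM.posSemidef)]
  exact hM.isUnit

end Matrices

namespace LagrangianSystem

variable {N : ℕ} (S : LagrangianSystem N)

theorem Kp_transpose : S.Kp.transpose = S.Kp := by
  rw [Kp, Matrix.transpose_nonsing_inv, transpose_sqrt]

theorem Kq_transpose : S.Kq.transpose = S.Kq := transpose_sqrt _

theorem Kp_mul_sqrt : S.Kp * CFC.sqrt S.α = 1 :=
  Matrix.nonsing_inv_mul _ (isUnit_det_sqrt S.α_posDef)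

theorem sqrt_mul_Kp : CFC.sqrt S.α * S.Kp = 1 :=
  Matrix.mul_nonsing_inv _ (isUnit_det_sqrt S.α_posDef)

/-- The damping matrix `2θ + βR`, the coefficient of `dQ/dt` in the equations of motion. -/
noncomputable def damping (β : ℝ) : Matrix (Fin N) (Fin N) ℝ := (2 : ℝ) • S.θ + β • S.R

/-- The matrix of `A(β)`, with the loss term `-iβB` absorbed into the block `-i K_p (2θ + βR) K_p`
and the transposes of the symmetric matrices `K_p`, `K_q` dropped. -/
noncomputable def AMatrix (β : ℝ) : Matrix (Fin N ⊕ Fin N) (Fin N ⊕ Fin N) ℂ :=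
  Matrix.fromBlocks ((-Complex.I) • (S.Kp * S.damping β * S.Kp).map Complex.ofReal)
    ((-Complex.I) • (S.Kp * S.Kq).map Complex.ofReal)
    (Complex.I • (S.Kq * S.Kp).map Complex.ofReal) 0

theorem OmegaMatrix_sub_smul_BMatrix (β : ℝ) :
    S.OmegaMatrix - (Complex.I * (β : ℂ)) • S.BMatrix = S.AMatrix β := by
  rw [OmegaMatrix, BMatrix, AMatrix, OmegaP, Phi, Matrix.fromBlocks_smul, sub_eq_add_neg,
    Matrix.fromBlocks_neg, Matrix.fromBlocks_add]
  simp only [smul_zero, neg_zero, add_zero, Matrix.transpose_mul, Kp_transpose, Kq_transpose]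
  congr 1
  ext i j
  simp only [damping, Matrix.mul_add, Matrix.add_mul, Matrix.mul_smul, Matrix.smul_mul,
    Matrix.neg_apply, Matrix.smul_apply, Matrix.map_apply, Matrix.add_apply, smul_eq_mul,
    Complex.ofReal_add, Complex.ofReal_mul, Complex.ofReal_ofNat]
  ring

theorem A_eq_toEuclideanLin (β : ℝ) : S.A β = Matrix.toEuclideanLin (S.AMatrix β) := by
  rw [← OmegaMatrix_sub_smul_BMatrix, map_sub, map_smul]
  rfl

theorem A_zero : S.A 0 = S.Omega := by simp [A]

theorem A_apply (β : ℝ) (x : StateSpace N) :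
    S.A β x = S.Omega x - (Complex.I * (β : ℂ)) • S.B x := rfl

theorem OmegaMatrix_isHermitian : S.OmegaMatrix.IsHermitian := by
  refine Matrix.IsHermitian.fromBlocks ?_ ?_ Matrix.isHermitian_zero
  · have hskew : (S.Kp * S.θ * S.Kp).transpose = -(S.Kp * S.θ * S.Kp) := by
      simp [Matrix.transpose_mul, Kp_transpose, S.θ_skew, Matrix.mul_assoc]
    rw [OmegaP, Kp_transpose, Matrix.IsHermitian, Matrix.conjTranspose_smul,
      conjTranspose_map_ofReal, hskew]
    ext i j
    simp
  · rw [Matrix.conjTranspose_smul, conjTranspose_map_ofReal, Matrix.transpose_transpose]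
    simp

theorem Omega_isSymmetric : S.Omega.IsSymmetric :=
  Matrix.isSymmetric_toEuclideanLin_iff.2 S.OmegaMatrix_isHermitian

open scoped ComplexOrder in
theorem BMatrix_posSemidef : S.BMatrix.PosSemidef := by
  obtain ⟨C, hC⟩ := CStarAlgebra.nonneg_iff_eq_star_mul_self.1
    (Matrix.nonneg_iff_posSemidef.2 S.R_posSemidef)
  set D : Matrix (Fin N ⊕ Fin N) (Fin N ⊕ Fin N) ℂ :=
    Matrix.fromBlocks ((C * S.Kp.transpose).map Complex.ofReal) 0 0 0
  have hD : S.BMatrix = D.conjTranspose * D := by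
    rw [Matrix.star_eq_conjTranspose, Matrix.conjTranspose_eq_transpose_of_trivial] at hC
    rw [Matrix.fromBlocks_conjTranspose, Matrix.fromBlocks_multiply, conjTranspose_map_ofReal,
      ← map_ofReal_mul, Matrix.transpose_mul, Matrix.transpose_transpose, BMatrix, hC]
    simp only [Matrix.conjTranspose_zero, Matrix.mul_zero, Matrix.zero_mul, add_zero,
      Matrix.mul_assoc]
  rw [hD]
  exact Matrix.posSemidef_conjTranspose_mul_self _

open scoped ComplexOrder in
theorem B_isPositive : S.B.IsPositive :=
  Matrix.isPositive_toEuclideanLin_iff.2 S.BMatrix_posSemidef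

theorem B_isSymmetric : S.B.IsSymmetric := S.B_isPositive.isSymmetric

theorem finrank_range_B : Module.finrank ℂ (LinearMap.range S.B) = S.R.rank := by
  have hdet : IsUnit S.Kp.det := Matrix.isUnit_det_of_right_inverse S.Kp_mul_sqrt
  calc Module.finrank ℂ (LinearMap.range S.B)
      = S.BMatrix.rank := (Matrix.rank_eq_finrank_range_toLin S.BMatrix
        (EuclideanSpace.basisFun _ ℂ).toBasis (EuclideanSpace.basisFun _ ℂ).toBasis).symm
    _ = (S.Kp * S.R * S.Kp.transpose).rank :=
        (rank_fromBlocks_zero _).trans (rank_map_ringHom Complex.ofRealHom _)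
    _ = S.R.rank := rank_mul_mul_of_isUnit_det hdet (by rwa [Matrix.det_transpose]) S.R

theorem finrank_stateSpace (N : ℕ) : Module.finrank ℂ (StateSpace N) = 2 * N := by
  rw [finrank_euclideanSpace, Fintype.card_sum, Fintype.card_fin, two_mul]

theorem finrank_ker_B : Module.finrank ℂ (LinearMap.ker S.B) + S.R.rank = 2 * N := by
  rw [← S.finrank_range_B, add_comm, LinearMap.finrank_range_add_finrank_ker,
    finrank_stateSpace]

/-- Entrywise complex conjugation on the state space, the antilinear symmetry behind
`σ(A(β)) = -conj σ(A(β))`. -/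
noncomputable def conjState : StateSpace N →ₛₗ[starRingEnd ℂ] StateSpace N where
  toFun x := WithLp.toLp 2 (star (WithLp.ofLp x))
  map_add' x y := by ext i; simp
  map_smul' c x := by ext i; simp

theorem conjState_apply (x : StateSpace N) (i : Fin N ⊕ Fin N) :
    conjState x i = starRingEnd ℂ (x i) := rfl

theorem conjState_conjState (x : StateSpace N) : conjState (conjState x) = x := by
  ext i
  simp [conjState_apply]

theorem conjState_injective : Function.Injective (conjState (N := N)) :=
  Function.LeftInverse.injective conjState_conjState

theorem A_conjState (β : ℝ) (x : StateSpace N) : S.A β (conjState x) = -conjState (S.A β x) := by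
  have hentries (i j) : S.AMatrix β i j = -starRingEnd ℂ (S.AMatrix β i j) := by
    rcases i with i | i <;> rcases j with j | j <;> simp [AMatrix]
  ext i
  simp only [A_eq_toEuclideanLin, Matrix.toLpLin_apply, conjState_apply, PiLp.neg_apply,
    Matrix.mulVec, dotProduct, map_sum, map_mul, ← Finset.sum_neg_distrib, ← neg_mul, ← hentries]

theorem neg_conj_mem_spectrum {β : ℝ} {ζ : ℂ} (hζ : ζ ∈ spectrum ℂ (S.A β)) :
    -(starRingEnd ℂ ζ) ∈ spectrum ℂ (S.A β) :=
  neg_conj_mem_spectrum_of_anticommute conjState_injective (S.A_conjState β) hζ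

/-- Exchange of the two components of the state space, which intertwines `A(β)⁻¹` with `-A♭(β)`. -/
noncomputable def swap : StateSpace N ≃ₗ[ℂ] StateSpace N :=
  (LinearIsometryEquiv.piLpCongrLeft 2 ℂ ℂ (Equiv.sumComm (Fin N) (Fin N))).toLinearEquiv

theorem swap_eq_toEuclideanLin (x : StateSpace N) :
    swap x = Matrix.toEuclideanLin
      (Matrix.fromBlocks 0 1 1 0 : Matrix (Fin N ⊕ Fin N) (Fin N ⊕ Fin N) ℂ) x := by
  have swap_apply (i : Fin N ⊕ Fin N) : swap x i = x i.swap := rfl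
  ext (i | i) <;> simp [swap_apply, Matrix.toLpLin_apply, Matrix.mulVec, dotProduct,
    Matrix.one_apply]

theorem AMatrix_mul_swap_mul_dual_AMatrix (h : S.η.PosDef) (β : ℝ) :
    S.AMatrix β * (Matrix.fromBlocks 0 1 1 0 * (S.dual h).AMatrix β)
      = -Matrix.fromBlocks 0 1 1 0 := by
  have dual_Kp : (S.dual h).Kp = S.Kq⁻¹ := rfl
  have dual_Kq : (S.dual h).Kq = CFC.sqrt S.α := rfl
  have dual_damping : (S.dual h).damping β = S.damping β := rfl
  have hKq : S.Kq * S.Kq⁻¹ = 1 := Matrix.mul_nonsing_inv _ (isUnit_det_sqrt h)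
  have hoff : S.Kp * (S.damping β * (S.Kp * (CFC.sqrt S.α * S.Kq⁻¹)))
      = S.Kp * (S.Kq * (S.Kq⁻¹ * (S.damping β * S.Kq⁻¹))) := by
    rw [← Matrix.mul_assoc S.Kp (CFC.sqrt S.α), Kp_mul_sqrt, Matrix.one_mul,
      ← Matrix.mul_assoc S.Kq, hKq, Matrix.one_mul]
  have hdiag_fst : S.Kp * (S.Kq * (S.Kq⁻¹ * CFC.sqrt S.α)) = 1 := by
    rw [← Matrix.mul_assoc S.Kq, hKq, Matrix.one_mul, Kp_mul_sqrt]
  have hdiag_snd : S.Kq * (S.Kp * (CFC.sqrt S.α * S.Kq⁻¹)) = 1 := by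
    rw [← Matrix.mul_assoc S.Kp, Kp_mul_sqrt, Matrix.one_mul, hKq]
  have map_one : (1 : Matrix (Fin N) (Fin N) ℝ).map Complex.ofReal = 1 :=
    Matrix.map_one _ Complex.ofReal_zero Complex.ofReal_one
  rw [AMatrix, AMatrix, Matrix.fromBlocks_multiply, Matrix.fromBlocks_multiply,
    Matrix.fromBlocks_neg, dual_Kp, dual_Kq, dual_damping]
  simp only [Matrix.zero_mul, Matrix.one_mul, zero_add, add_zero, Matrix.mul_zero, Matrix.smul_mul,
    Matrix.mul_smul, smul_zero, smul_smul, ← map_ofReal_mul, Matrix.mul_assoc, hoff, hdiag_fst,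
    hdiag_snd, map_one]
  simp

theorem A_swap_dual_A (h : S.η.PosDef) (β : ℝ) (x : StateSpace N) :
    S.A β (swap ((S.dual h).A β x)) = -swap x := by
  simp only [swap_eq_toEuclideanLin, A_eq_toEuclideanLin, Matrix.toLpLin_apply,
    Matrix.mulVec_mulVec, AMatrix_mul_swap_mul_dual_AMatrix, Matrix.neg_mulVec]
  rfl

theorem dual_A_swap_A (h : S.η.PosDef) (β : ℝ) (x : StateSpace N) :
    (S.dual h).A β (swap (S.A β x)) = -swap x :=
  (S.dual h).A_swap_dual_A S.α_posDef β x

theorem zero_notMem_spectrum_A (h : S.η.PosDef) (β : ℝ) : (0 : ℂ) ∉ spectrum ℂ (S.A β) :=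
  zero_notMem_spectrum_of_reciprocal (S.dual_A_swap_A h β)

theorem neg_inv_mem_spectrum_dual (h : S.η.PosDef) {β : ℝ} {ζ : ℂ}
    (hζ : ζ ∈ spectrum ℂ (S.A β)) : -ζ⁻¹ ∈ spectrum ℂ ((S.dual h).A β) :=
  neg_inv_mem_spectrum_of_reciprocal (S.dual_A_swap_A h β) hζ

theorem finite_setOf_ofReal_mem_spectrum (T : Module.End ℂ (StateSpace N)) :
    {μ : ℝ | (μ : ℂ) ∈ spectrum ℂ T}.Finite :=
  (Module.End.finite_spectrum T).preimage Complex.ofReal_injective.injOn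

theorem isLeast_sInf_of_ofReal_mem_spectrum {T : Module.End ℂ (StateSpace N)} {s : Set ℝ}
    (hs : s.Nonempty) (hsT : ∀ μ ∈ s, (μ : ℂ) ∈ spectrum ℂ T) : IsLeast s (sInf s) :=
  have hfin : s.Finite := (finite_setOf_ofReal_mem_spectrum T).subset hsT
  ⟨hs.csInf_mem hfin, fun _ h => csInf_le hfin.bddBelow h⟩

theorem neg_mem_spectrum_Omega {μ : ℝ} (h : (μ : ℂ) ∈ spectrum ℂ S.Omega) :
    ((-μ : ℝ) : ℂ) ∈ spectrum ℂ S.Omega := by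
  rw [← A_zero] at h ⊢
  simpa using S.neg_conj_mem_spectrum h

theorem abs_mem_spectrum_Omega {μ : ℝ} (h : (μ : ℂ) ∈ spectrum ℂ S.Omega) :
    ((|μ| : ℝ) : ℂ) ∈ spectrum ℂ S.Omega := by
  rcases abs_choice μ with habs | habs <;> rw [habs]
  exacts [h, S.neg_mem_spectrum_Omega h]

theorem zero_notMem_spectrum_Omega (h : S.η.PosDef) : (0 : ℂ) ∉ spectrum ℂ S.Omega := by
  rw [← A_zero]
  exact S.zero_notMem_spectrum_A h 0

include S in
theorem nontrivial_stateSpace : Nontrivial (StateSpace N) := by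
  have hN : 0 < N := S.R_rank_pos.trans_le (by simpa using Matrix.rank_le_card_width S.R)
  have : Nonempty (Fin N) := ⟨⟨0, hN⟩⟩
  infer_instance

theorem exists_real_mem_spectrum_Omega : ∃ μ : ℝ, (μ : ℂ) ∈ spectrum ℂ S.Omega := by
  have := S.nontrivial_stateSpace
  obtain ⟨ζ, hζ⟩ := spectrum.nonempty_of_isAlgClosed_of_finiteDimensional ℂ S.Omega
  obtain ⟨μ, rfl⟩ := exists_ofReal_eq_of_mem_spectrum S.Omega_isSymmetric hζ
  exact ⟨μ, hζ⟩

theorem isGreatest_omegaMax : IsGreatest {ω : ℝ | (ω : ℂ) ∈ spectrum ℂ S.Omega} S.omegaMax :=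
  have hfin := finite_setOf_ofReal_mem_spectrum S.Omega
  ⟨Set.Nonempty.csSup_mem S.exists_real_mem_spectrum_Omega hfin,
    fun _ h => le_csSup hfin.bddAbove h⟩

theorem abs_le_omegaMax {μ : ℝ} (h : (μ : ℂ) ∈ spectrum ℂ S.Omega) : |μ| ≤ S.omegaMax :=
  S.isGreatest_omegaMax.2 (S.abs_mem_spectrum_Omega h)

theorem omegaMax_nonneg : 0 ≤ S.omegaMax :=
  (abs_nonneg _).trans (S.abs_le_omegaMax S.isGreatest_omegaMax.1)

theorem norm_Omega_le (x : StateSpace N) : ‖S.Omega x‖ ≤ S.omegaMax * ‖x‖ :=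
  norm_apply_le_of_spectrum S.Omega_isSymmetric S.omegaMax_nonneg
    (fun _ hμ => S.abs_le_omegaMax hμ) x

theorem isLeast_omegaMin (h : S.η.PosDef) :
    IsLeast {ω : ℝ | 0 < ω ∧ (ω : ℂ) ∈ spectrum ℂ S.Omega} S.omegaMin := by
  obtain ⟨μ, hμ⟩ := S.exists_real_mem_spectrum_Omega
  have hμ0 : μ ≠ 0 := by
    rintro rfl
    exact S.zero_notMem_spectrum_Omega h (by simpa using hμ)
  exact isLeast_sInf_of_ofReal_mem_spectrum ⟨|μ|, abs_pos.2 hμ0, S.abs_mem_spectrum_Omega hμ⟩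
    fun _ hω => hω.2

theorem omegaMin_pos (h : S.η.PosDef) : 0 < S.omegaMin := (S.isLeast_omegaMin h).1.1

theorem omegaMin_le_omegaMax (h : S.η.PosDef) : S.omegaMin ≤ S.omegaMax :=
  S.isGreatest_omegaMax.2 (S.isLeast_omegaMin h).1.2

theorem omegaMax_pos (h : S.η.PosDef) : 0 < S.omegaMax :=
  (S.omegaMin_pos h).trans_le (S.omegaMin_le_omegaMax h)

theorem inv_mem_spectrum_dual_Omega (h : S.η.PosDef) {μ : ℝ}
    (hμ : (μ : ℂ) ∈ spectrum ℂ S.Omega) : ((μ⁻¹ : ℝ) : ℂ) ∈ spectrum ℂ (S.dual h).Omega := by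
  rw [← neg_neg μ⁻¹]
  apply neg_mem_spectrum_Omega
  rw [← A_zero] at hμ ⊢
  simpa using S.neg_inv_mem_spectrum_dual h hμ

theorem dual_omegaMax (h : S.η.PosDef) : (S.dual h).omegaMax = S.omegaMin⁻¹ := by
  have hpos := (S.dual h).omegaMax_pos S.α_posDef
  apply le_antisymm
  · rw [le_inv_comm₀ hpos (S.omegaMin_pos h)]
    exact (S.isLeast_omegaMin h).2 ⟨inv_pos.2 hpos,
      (S.dual h).inv_mem_spectrum_dual_Omega S.α_posDef (S.dual h).isGreatest_omegaMax.1⟩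
  · exact (S.dual h).isGreatest_omegaMax.2
      (S.inv_mem_spectrum_dual_Omega h (S.isLeast_omegaMin h).1.2)

theorem dual_omegaMin (h : S.η.PosDef) : (S.dual h).omegaMin = S.omegaMax⁻¹ := by
  rw [← inv_inv (S.dual h).omegaMin, ← (S.dual h).dual_omegaMax S.α_posDef]
  rfl

theorem nonneg_of_mem_spectrum_B {b : ℝ} (hb : (b : ℂ) ∈ spectrum ℂ S.B) : 0 ≤ b := by
  obtain ⟨w, hw0, hw⟩ := mem_spectrum_iff_exists_eigenvector.1 hb
  have hnonneg : 0 ≤ b * ‖w‖ ^ 2 := by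
    have hinner : inner ℂ w (S.B w) = ((b * ‖w‖ ^ 2 : ℝ) : ℂ) := by
      rw [hw, inner_smul_right, inner_self_eq_norm_sq_to_K]
      simp
    rw [← Complex.ofReal_re (b * ‖w‖ ^ 2), ← hinner]
    exact S.B_isPositive.re_inner_nonneg_right w
  exact nonneg_of_mul_nonneg_left hnonneg (by positivity)

theorem isLeast_bMin : IsLeast {b : ℝ | b ≠ 0 ∧ (b : ℂ) ∈ spectrum ℂ S.B} S.bMin := by
  refine isLeast_sInf_of_ofReal_mem_spectrum ?_ fun _ hb => hb.2
  by_contra hempty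
  have hspec (μ : ℝ) (hμ : (μ : ℂ) ∈ spectrum ℂ S.B) : |μ| ≤ 0 := by
    by_contra hμ0
    exact hempty ⟨μ, by simpa using hμ0, hμ⟩
  have hB : S.B = 0 := by
    ext1 x
    simpa using norm_apply_le_of_spectrum S.B_isSymmetric le_rfl hspec x
  have hrank := S.finrank_range_B
  rw [hB, LinearMap.range_zero, finrank_bot] at hrank
  exact S.R_rank_pos.ne hrank

theorem bMin_pos : 0 < S.bMin :=
  (S.nonneg_of_mem_spectrum_B S.isLeast_bMin.1.2).lt_of_ne' S.isLeast_bMin.1.1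

theorem bMin_mul_norm_le {x : StateSpace N} (hx : x ∈ (LinearMap.ker S.B)ᗮ) :
    S.bMin * ‖x‖ ≤ ‖S.B x‖ :=
  mul_norm_le_norm_apply_of_spectrum S.B_isSymmetric S.bMin_pos.le
    (fun _ hμ hμ0 => (S.isLeast_bMin.2 ⟨hμ0, hμ⟩).trans (le_abs_self _)) hx

theorem im_nonpos_of_mem_spectrum {β : ℝ} (hβ : 0 ≤ β) {ζ : ℂ} (hζ : ζ ∈ spectrum ℂ (S.A β)) :
    ζ.im ≤ 0 := by
  obtain ⟨w, hw0, hw⟩ := mem_spectrum_iff_exists_eigenvector.1 hζ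
  have hΩ : (inner ℂ w (S.Omega w)).im = 0 := by
    rw [← Complex.conj_eq_iff_im, inner_conj_symm]
    exact S.Omega_isSymmetric w w
  have hB : 0 ≤ (inner ℂ w (S.B w)).re := S.B_isPositive.re_inner_nonneg_right w
  have hdissipation : ζ.im * ‖w‖ ^ 2 = -(β * (inner ℂ w (S.B w)).re) := by
    calc ζ.im * ‖w‖ ^ 2 = (inner ℂ w (S.A β w)).im := by
          rw [hw, inner_smul_right, inner_self_eq_norm_sq_to_K, ← RCLike.ofReal_pow]
          exact (Complex.im_mul_ofReal _ _).symm
      _ = -(β * (inner ℂ w (S.B w)).re) := by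
          rw [A_apply, inner_sub_right, inner_smul_right, Complex.sub_im, hΩ]
          simp [mul_assoc]
  refine nonpos_of_mul_nonpos_left ?_ (by positivity : 0 < ‖w‖ ^ 2)
  rw [hdissipation]
  exact neg_nonpos.2 (mul_nonneg hβ hB)

theorem A_apply_eq_neg_smul_add (β : ℝ) (x : StateSpace N) :
    S.A β x = (-(Complex.I * (β : ℂ)) • S.B) x + S.Omega x := by
  rw [A_apply, LinearMap.smul_apply, neg_smul, neg_add_eq_sub]

theorem norm_neg_I_mul {β : ℝ} (hβ : 0 ≤ β) : ‖-(Complex.I * (β : ℂ))‖ = β := by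
  simp [abs_of_nonneg hβ]

theorem ker_neg_smul_B {β : ℝ} (hβ : 0 < β) :
    LinearMap.ker (-(Complex.I * (β : ℂ)) • S.B) = LinearMap.ker S.B :=
  LinearMap.ker_smul _ _ (norm_ne_zero_iff.1 (by rw [norm_neg_I_mul hβ.le]; exact hβ.ne'))

theorem neg_smul_B_mem_orthogonal {β : ℝ} (hβ : 0 < β) (x : StateSpace N) :
    (-(Complex.I * (β : ℂ)) • S.B) x ∈ (LinearMap.ker (-(Complex.I * (β : ℂ)) • S.B))ᗮ := by
  rw [S.ker_neg_smul_B hβ]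
  exact Submodule.smul_mem _ _ (apply_mem_orthogonal_ker_of_isSymmetric S.B_isSymmetric x)

theorem mul_norm_le_norm_neg_smul_B {β : ℝ} (hβ : 0 < β) {u : StateSpace N}
    (hu : u ∈ (LinearMap.ker (-(Complex.I * (β : ℂ)) • S.B))ᗮ) :
    β * S.bMin * ‖u‖ ≤ ‖(-(Complex.I * (β : ℂ)) • S.B) u‖ := by
  rw [S.ker_neg_smul_B hβ] at hu
  rw [LinearMap.smul_apply, norm_smul, norm_neg_I_mul hβ.le, mul_assoc]
  exact mul_le_mul_of_nonneg_left (S.bMin_mul_norm_le hu) hβ.le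

section FirstDichotomy

variable {S} {β : ℝ}

theorem pos_of_two_mul_omegaMax_div_lt (hβ : 2 * S.omegaMax / S.bMin < β) : 0 < β :=
  (div_nonneg (mul_nonneg zero_le_two S.omegaMax_nonneg) S.bMin_pos.le).trans_lt hβ

theorem omegaMax_lt_half_mul_bMin (hβ : 2 * S.omegaMax / S.bMin < β) :
    S.omegaMax < β * S.bMin / 2 := by
  linarith [(div_lt_iff₀ S.bMin_pos).1 hβ]

theorem spectrum_A_eq_union (S : LagrangianSystem N) (β : ℝ) :
    spectrum ℂ (S.A β) = S.sigma0 β ∪ S.sigma1 β := by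
  refine Set.Subset.antisymm (fun ζ hζ => ?_)
    (Set.union_subset Set.inter_subset_left Set.inter_subset_left)
  obtain ⟨w, hw0, hw⟩ := mem_spectrum_iff_exists_eigenvector.1 hζ
  have hbauerFike : ‖-(Complex.I * (β : ℂ)) • S.B w - ζ • w‖ ≤ S.omegaMax * ‖w‖ := by
    rw [← hw, A_apply, neg_smul, neg_sub_left, sub_add_cancel, norm_neg]
    exact S.norm_Omega_le w
  obtain ⟨b, hb, hbζ⟩ := exists_eigenvalue_norm_sub_le S.B_isSymmetric hw0 hbauerFike
  rw [norm_sub_rev, neg_mul] at hbζ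
  by_cases hb0 : b = 0
  · exact Or.inl ⟨hζ, by simpa [hb0] using hbζ⟩
  · exact Or.inr ⟨hζ, Set.mem_biUnion (x := b) ⟨hb0, hb⟩ (mem_closedBall_iff_norm.2 hbζ)⟩

theorem norm_le_of_mem_sigma0 {ζ : ℂ} (hζ : ζ ∈ S.sigma0 β) : ‖ζ‖ ≤ S.omegaMax :=
  mem_closedBall_zero_iff.1 hζ.2

theorem half_mul_bMin_lt_norm_of_mem_sigma1 (hβ : 2 * S.omegaMax / S.bMin < β) {ζ : ℂ}
    (hζ : ζ ∈ S.sigma1 β) : β * S.bMin / 2 < ‖ζ‖ := by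
  have hβ0 := pos_of_two_mul_omegaMax_div_lt hβ
  obtain ⟨b, hb, hζb⟩ := Set.mem_iUnion₂.1 hζ.2
  have hcenter : ‖-(Complex.I * (β : ℂ) * b)‖ = β * b := by
    rw [← neg_mul, norm_mul, norm_neg_I_mul hβ0.le, Complex.norm_real,
      Real.norm_of_nonneg (S.nonneg_of_mem_spectrum_B hb.2)]
  have hdist := norm_le_norm_add_norm_sub' (-(Complex.I * (β : ℂ) * b)) ζ
  rw [hcenter, norm_sub_rev, ← dist_eq_norm] at hdist
  have hb_le : β * S.bMin ≤ β * b := mul_le_mul_of_nonneg_left (S.isLeast_bMin.2 hb) hβ0.le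
  linarith [Metric.mem_closedBall.1 hζb, omegaMax_lt_half_mul_bMin hβ]

theorem disjoint_sigma0_sigma1 (hβ : 2 * S.omegaMax / S.bMin < β) :
    Disjoint (S.sigma0 β) (S.sigma1 β) :=
  Set.disjoint_left.2 fun _ hζ₀ hζ₁ => ((norm_le_of_mem_sigma0 hζ₀).trans_lt
    (omegaMax_lt_half_mul_bMin hβ)).not_gt (half_mul_bMin_lt_norm_of_mem_sigma1 hβ hζ₁)

theorem projectionForm_ker_B_A_lt (hβ : 2 * S.omegaMax / S.bMin < β) {x : StateSpace N}
    (hx : x ≠ 0) : projectionForm (LinearMap.ker S.B) (S.A β x)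
      < (β * S.bMin / 2) ^ 2 * projectionForm (LinearMap.ker S.B) x := by
  have hβ0 := pos_of_two_mul_omegaMax_div_lt hβ
  have hs := omegaMax_lt_half_mul_bMin hβ
  rw [A_apply_eq_neg_smul_add, ← S.ker_neg_smul_B hβ0]
  refine projectionForm_ker_apply_add_lt (S.neg_smul_B_mem_orthogonal hβ0)
    (S.omegaMax_nonneg.trans hs.le) (fun u hu => ?_) ((S.norm_Omega_le x).trans_lt ?_)
  · rw [mul_div_cancel₀ _ two_ne_zero]
    exact S.mul_norm_le_norm_neg_smul_B hβ0 hu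
  · exact mul_lt_mul_of_pos_right hs (norm_pos_iff.2 hx)

theorem restrictedSpectrum_Hll : restrictedSpectrum (S.A β) (S.Hll β) = S.sigma0 β :=
  restrictedSpectrum_spectralSubspace Set.inter_subset_left

theorem restrictedSpectrum_Hhl : restrictedSpectrum (S.A β) (S.Hhl β) = S.sigma1 β :=
  restrictedSpectrum_spectralSubspace Set.inter_subset_left

theorem projectionForm_ker_B_pos_of_mem_Hll (hβ : 2 * S.omegaMax / S.bMin < β)
    {x : StateSpace N} (hx : x ∈ S.Hll β) (hx0 : x ≠ 0) :
    0 < projectionForm (LinearMap.ker S.B) x := by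
  have hs := omegaMax_lt_half_mul_bMin hβ
  refine pos_of_restrictedSpectrum_lt (apply_mem_spectralSubspace _ _)
    (S.omegaMax_nonneg.trans_lt hs) (fun ζ hζ => ?_) (continuous_projectionForm _)
    (projectionForm_smul _) (fun x _ hx0 => projectionForm_ker_B_A_lt hβ hx0) hx hx0
  rw [← Hll, restrictedSpectrum_Hll] at hζ
  exact (norm_le_of_mem_sigma0 hζ).trans_lt hs

theorem projectionForm_ker_B_neg_of_mem_Hhl (hβ : 2 * S.omegaMax / S.bMin < β)
    {x : StateSpace N} (hx : x ∈ S.Hhl β) (hx0 : x ≠ 0) :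
    projectionForm (LinearMap.ker S.B) x < 0 := by
  refine neg_of_lt_restrictedSpectrum (apply_mem_spectralSubspace _ _)
    (S.omegaMax_nonneg.trans_lt (omegaMax_lt_half_mul_bMin hβ)) (fun ζ hζ => ?_)
    (continuous_projectionForm _) (projectionForm_smul _)
    (fun x _ hx0 => projectionForm_ker_B_A_lt hβ hx0) hx hx0
  rw [← Hhl, restrictedSpectrum_Hhl] at hζ
  exact half_mul_bMin_lt_norm_of_mem_sigma1 hβ hζ

theorem isCompl_Hhl_Hll (hβ : 2 * S.omegaMax / S.bMin < β) : IsCompl (S.Hhl β) (S.Hll β) :=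
  isCompl_spectralSubspace (disjoint_sigma0_sigma1 hβ).symm
    ((S.spectrum_A_eq_union β).trans (Set.union_comm _ _))

theorem finrank_Hhl_and_Hll (hβ : 2 * S.omegaMax / S.bMin < β) :
    Module.finrank ℂ (S.Hhl β) = S.R.rank ∧ Module.finrank ℂ (S.Hll β) + S.R.rank = 2 * N := by
  have hHll : Module.finrank ℂ (S.Hll β) ≤ Module.finrank ℂ (LinearMap.ker S.B) :=
    finrank_le_of_projectionForm_pos fun _ hx hx0 => projectionForm_ker_B_pos_of_mem_Hll hβ hx hx0
  have hHhl : Module.finrank ℂ (S.Hhl β) ≤ Module.finrank ℂ (LinearMap.ker S.B)ᗮ :=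
    finrank_le_of_projectionForm_neg fun _ hx hx0 => projectionForm_ker_B_neg_of_mem_Hhl hβ hx hx0
  have hker := Submodule.finrank_add_finrank_orthogonal (LinearMap.ker S.B)
  have htotal := Submodule.finrank_add_eq_of_isCompl (isCompl_Hhl_Hll hβ)
  have hrank := S.finrank_ker_B
  rw [finrank_stateSpace] at htotal hker
  omega

theorem modalDichotomyI (hβ : 2 * S.omegaMax / S.bMin < β) : S.ModalDichotomyI β where
  spectrum_union := S.spectrum_A_eq_union β
  spectrum_disjoint := Set.disjoint_iff_inter_eq_empty.1 (disjoint_sigma0_sigma1 hβ)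
  splitting := ⟨apply_mem_spectralSubspace _ _, apply_mem_spectralSubspace _ _,
    isCompl_Hhl_Hll hβ, restrictedSpectrum_Hll, restrictedSpectrum_Hhl⟩
  unique _ _ hsplit := eq_spectralSubspace_of_sup_eq hsplit.invariant_h hsplit.invariant_l
    hsplit.spectrum_h hsplit.spectrum_l (disjoint_sigma0_sigma1 hβ).symm
    (hsplit.isCompl.sup_eq_top.trans (isCompl_Hhl_Hll hβ).sup_eq_top.symm)
  finrank_h := (finrank_Hhl_and_Hll hβ).1
  finrank_l := Nat.eq_sub_of_add_eq (finrank_Hhl_and_Hll hβ).2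

end FirstDichotomy

section SecondDichotomy

variable {S} {β : ℝ}

theorem norm_pos_of_mem_spectrum_A (h : S.η.PosDef) {ζ : ℂ} (hζ : ζ ∈ spectrum ℂ (S.A β)) :
    0 < ‖ζ‖ := by
  rw [norm_pos_iff]
  rintro rfl
  exact S.zero_notMem_spectrum_A h β hζ

theorem spectrum_inter_norm_eq_image_neg_conj (p : ℝ → Prop) :
    spectrum ℂ (S.A β) ∩ {ζ | p ‖ζ‖}
      = (fun ζ => -(starRingEnd ℂ) ζ) '' (spectrum ℂ (S.A β) ∩ {ζ | p ‖ζ‖}) := by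
  have hclosed {ζ : ℂ} (hζ : ζ ∈ spectrum ℂ (S.A β) ∩ {ζ | p ‖ζ‖}) :
      -(starRingEnd ℂ) ζ ∈ spectrum ℂ (S.A β) ∩ {ζ | p ‖ζ‖} :=
    ⟨S.neg_conj_mem_spectrum hζ.1, by simpa only [Set.mem_ofPred_eq, norm_neg, RCLike.norm_conj]
      using hζ.2⟩
  refine Set.Subset.antisymm (fun ζ hζ => ⟨_, hclosed hζ, by simp⟩) ?_
  rintro _ ⟨ζ, hζ, rfl⟩
  exact hclosed hζ

theorem spectrum_inter_norm_eq_image_neg_inv (h : S.η.PosDef) {p q : ℝ → Prop}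
    (hpq : ∀ r, 0 < r → (p r ↔ q r⁻¹)) :
    spectrum ℂ (S.A β) ∩ {ζ | p ‖ζ‖}
      = (fun ζ => -ζ⁻¹) '' (spectrum ℂ ((S.dual h).A β) ∩ {ζ | q ‖ζ‖}) := by
  rw [← spectrum_inter_eq_image_of_reciprocal ((S.dual h).dual_A_swap_A S.α_posDef β)]
  refine Set.ext fun ζ => and_congr_right fun hζ => ?_
  rw [Set.mem_ofPred_eq, Set.mem_ofPred_eq, Set.mem_ofPred_eq, norm_neg, norm_inv]
  exact hpq _ (norm_pos_of_mem_spectrum_A h hζ)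

theorem sigma1_eq_inter (hβ : 2 * S.omegaMax / S.bMin < β) :
    S.sigma1 β = spectrum ℂ (S.A β) ∩ {ζ | S.omegaMax < ‖ζ‖} := by
  refine Set.Subset.antisymm (fun ζ hζ => ⟨hζ.1, (omegaMax_lt_half_mul_bMin hβ).trans
    (half_mul_bMin_lt_norm_of_mem_sigma1 hβ hζ)⟩) fun ζ hζ => ?_
  exact ((S.spectrum_A_eq_union β).subset hζ.1).resolve_left
    fun hζ₀ => (norm_le_of_mem_sigma0 hζ₀).not_gt hζ.2

theorem sigma0_eq_union (h : S.η.PosDef) : S.sigma0 β = S.sigmaLow β ∪ S.sigmaMid β := by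
  rw [sigma0, sigmaLow, sigmaMid, ← Set.inter_union_distrib_left]
  congr 1
  ext ζ
  have hω := S.omegaMin_le_omegaMax h
  rw [mem_closedBall_zero_iff, Set.mem_union, Set.mem_ofPred_eq, Set.mem_ofPred_eq]
  exact ⟨fun hζ => (lt_or_ge _ _).imp_right fun hmin => ⟨hmin, hζ⟩,
    Or.rec (fun hlt => hlt.le.trans hω) And.right⟩

theorem disjoint_sigmaLow_sigmaMid : Disjoint (S.sigmaLow β) (S.sigmaMid β) :=
  Set.disjoint_left.2 fun _ hlow hmid => (Set.mem_ofPred_eq ▸ hlow.2).not_ge hmid.2.1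

theorem sigmaLow_eq_image (h : S.η.PosDef)
    (hβ' : 2 * (S.dual h).omegaMax / (S.dual h).bMin < β) :
    S.sigmaLow β = (fun ζ => -ζ⁻¹) '' (S.dual h).sigma1 β := by
  rw [sigma1_eq_inter hβ', dual_omegaMax]
  exact spectrum_inter_norm_eq_image_neg_inv h (p := fun r => r < S.omegaMin)
    fun r hr => (inv_lt_inv₀ (S.omegaMin_pos h) hr).symm

theorem sigma1_eq_image (h : S.η.PosDef) (hβ : 2 * S.omegaMax / S.bMin < β) :
    S.sigma1 β = (fun ζ => -ζ⁻¹) '' (S.dual h).sigmaLow β := by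
  rw [sigma1_eq_inter hβ, sigmaLow, dual_omegaMin]
  exact spectrum_inter_norm_eq_image_neg_inv h (q := fun r => r < S.omegaMax⁻¹)
    fun r hr => (inv_lt_inv₀ hr (S.omegaMax_pos h)).symm

theorem sigmaMid_eq_image (h : S.η.PosDef) :
    S.sigmaMid β = (fun ζ => -ζ⁻¹) '' (S.dual h).sigmaMid β := by
  rw [sigmaMid, sigmaMid, dual_omegaMin, dual_omegaMax]
  refine spectrum_inter_norm_eq_image_neg_inv h (p := fun r => S.omegaMin ≤ r ∧ r ≤ S.omegaMax)
    (q := fun r => S.omegaMax⁻¹ ≤ r ∧ r ≤ S.omegaMin⁻¹) fun r hr => ?_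
  rw [inv_le_inv₀ (S.omegaMax_pos h) hr, inv_le_inv₀ hr (S.omegaMin_pos h), and_comm]

theorem restrictedSpectrum_Hll0 : restrictedSpectrum (S.A β) (S.Hll0 β) = S.sigmaLow β :=
  restrictedSpectrum_spectralSubspace Set.inter_subset_left

theorem restrictedSpectrum_Hll1 : restrictedSpectrum (S.A β) (S.Hll1 β) = S.sigmaMid β :=
  restrictedSpectrum_spectralSubspace Set.inter_subset_left

theorem finrank_Hll0 (h : S.η.PosDef)
    (hβ' : 2 * (S.dual h).omegaMax / (S.dual h).bMin < β) :
    Module.finrank ℂ (S.Hll0 β) = S.R.rank := by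
  rw [Hll0, sigmaLow_eq_image h hβ']
  exact (finrank_spectralSubspace_of_reciprocal ((S.dual h).dual_A_swap_A S.α_posDef β)
    Set.inter_subset_left).symm.trans (finrank_Hhl_and_Hll hβ').1

theorem Hll0_sup_Hll1 (h : S.η.PosDef) : S.Hll0 β ⊔ S.Hll1 β = S.Hll β := by
  rw [Hll0, Hll1, Hll, ← spectralSubspace_union, ← sigma0_eq_union h]

theorem disjoint_Hll0_Hll1 : Disjoint (S.Hll0 β) (S.Hll1 β) :=
  disjoint_spectralSubspace _ disjoint_sigmaLow_sigmaMid

theorem finrank_Hll1 (h : S.η.PosDef) (hβ : 2 * S.omegaMax / S.bMin < β)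
    (hβ' : 2 * (S.dual h).omegaMax / (S.dual h).bMin < β) :
    Module.finrank ℂ (S.Hll1 β) = 2 * N - 2 * S.R.rank := by
  have hsum := Submodule.finrank_sup_add_finrank_inf_eq (S.Hll0 β) (S.Hll1 β)
  rw [Hll0_sup_Hll1 h, disjoint_Hll0_Hll1.eq_bot, finrank_bot, finrank_Hll0 h hβ'] at hsum
  have hHll := (finrank_Hhl_and_Hll hβ).2
  omega

theorem modalDichotomyII (h : S.η.PosDef) (hβ : 2 * S.omegaMax / S.bMin < β)
    (hβ' : 2 * (S.dual h).omegaMax / (S.dual h).bMin < β) : S.ModalDichotomyII h β where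
  splitting := ⟨apply_mem_spectralSubspace _ _, apply_mem_spectralSubspace _ _, Hll0_sup_Hll1 h,
    disjoint_Hll0_Hll1, restrictedSpectrum_Hll0, restrictedSpectrum_Hll1⟩
  unique _ _ hsplit := eq_spectralSubspace_of_sup_eq hsplit.invariant_0 hsplit.invariant_1
    hsplit.spectrum_0 hsplit.spectrum_1 disjoint_sigmaLow_sigmaMid
    (hsplit.sup_eq.trans (Hll0_sup_Hll1 h).symm)
  finrank_0 := finrank_Hll0 h hβ'
  finrank_1 := finrank_Hll1 h hβ hβ'
  symm_0 := by
    rw [restrictedSpectrum_Hll0]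
    exact spectrum_inter_norm_eq_image_neg_conj (· < S.omegaMin)
  dual_0 := by
    rw [restrictedSpectrum_Hll0, restrictedSpectrum_Hhl]
    exact sigmaLow_eq_image h hβ'
  symm_h := by
    rw [restrictedSpectrum_Hhl, sigma1_eq_inter hβ]
    exact spectrum_inter_norm_eq_image_neg_conj (S.omegaMax < ·)
  dual_h := by
    rw [restrictedSpectrum_Hll0, restrictedSpectrum_Hhl]
    exact sigma1_eq_image h hβ
  symm_1 := by
    rw [restrictedSpectrum_Hll1]
    exact spectrum_inter_norm_eq_image_neg_conj fun r => S.omegaMin ≤ r ∧ r ≤ S.omegaMax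
  dual_1 := by
    rw [restrictedSpectrum_Hll1, restrictedSpectrum_Hll1]
    exact sigmaMid_eq_image h

end SecondDichotomy

theorem compressedOmega_apply (x : StateSpace N) :
    S.compressedOmega x = (LinearMap.ker S.B).starProjection
      (S.Omega ((LinearMap.ker S.B).starProjection x)) := rfl

theorem compressedOmega_starProjection (x : StateSpace N) :
    S.compressedOmega ((LinearMap.ker S.B).starProjection x) = S.compressedOmega x := by
  rw [compressedOmega_apply, compressedOmega_apply,
    Submodule.starProjection_eq_self_iff.2 (Submodule.starProjection_apply_mem _ x)]

theorem compressedOmega_isSymmetric : S.compressedOmega.IsSymmetric := fun x y => by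
  have hP := (LinearMap.ker S.B).starProjection_isSymmetric
  rw [compressedOmega_apply, compressedOmega_apply]
  exact (hP _ _).trans ((S.Omega_isSymmetric _ _).trans (hP _ _))

theorem inner_conjState (x y : StateSpace N) :
    inner ℂ (conjState x) (conjState y) = inner ℂ y x := by
  simp only [PiLp.inner_apply, conjState_apply, RCLike.inner_apply, RCLike.conj_conj, mul_comm]

theorem Omega_conjState (x : StateSpace N) : S.Omega (conjState x) = -conjState (S.Omega x) := by
  rw [← A_zero, A_conjState]

theorem conjState_mem_ker_B {x : StateSpace N} (hx : x ∈ LinearMap.ker S.B) :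
    conjState x ∈ LinearMap.ker S.B := by
  have hA := S.A_conjState 1 x
  rw [A_apply, A_apply, Omega_conjState, LinearMap.mem_ker.1 hx, smul_zero, sub_zero,
    sub_eq_self, smul_eq_zero] at hA
  exact hA.resolve_left (by simp)

theorem starProjection_ker_B_conjState (x : StateSpace N) :
    (LinearMap.ker S.B).starProjection (conjState x)
      = conjState ((LinearMap.ker S.B).starProjection x) := by
  refine Submodule.eq_starProjection_of_mem_orthogonal'
    (z := conjState ((LinearMap.ker S.B)ᗮ.starProjection x))
    (S.conjState_mem_ker_B (Submodule.starProjection_apply_mem _ x)) (fun w hw => ?_) ?_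
  · rw [← conjState_conjState w, inner_conjState]
    exact Submodule.inner_left_of_mem_orthogonal (S.conjState_mem_ker_B hw)
      (Submodule.starProjection_apply_mem _ x)
  · rw [← map_add, Submodule.starProjection_add_starProjection_orthogonal]

theorem compressedOmega_conjState (x : StateSpace N) :
    S.compressedOmega (conjState x) = -conjState (S.compressedOmega x) := by
  rw [compressedOmega_apply, starProjection_ker_B_conjState, Omega_conjState, map_neg,
    starProjection_ker_B_conjState, ← compressedOmega_apply]

theorem abs_mem_spectrum_compressedOmega {μ : ℝ} (h : (μ : ℂ) ∈ spectrum ℂ S.compressedOmega) :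
    ((|μ| : ℝ) : ℂ) ∈ spectrum ℂ S.compressedOmega := by
  rcases abs_choice μ with habs | habs <;> rw [habs]
  · exact h
  · simpa using
      neg_conj_mem_spectrum_of_anticommute conjState_injective S.compressedOmega_conjState h

theorem ker_Omega (h : S.η.PosDef) : LinearMap.ker S.Omega = ⊥ :=
  LinearMap.ker_eq_bot'.2 fun x hx => by
    by_contra hx0
    exact S.zero_notMem_spectrum_Omega h
      (mem_spectrum_iff_exists_eigenvector.2 ⟨x, hx0, by rw [hx, zero_smul]⟩)

theorem finrank_ker_B_inf_ker_compressedOmega_le (h : S.η.PosDef) :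
    Module.finrank ℂ (LinearMap.ker S.B ⊓ LinearMap.ker S.compressedOmega : Submodule ℂ _)
      ≤ S.R.rank := by
  have hmap : (LinearMap.ker S.B ⊓ LinearMap.ker S.compressedOmega).map S.Omega
      ≤ (LinearMap.ker S.B)ᗮ := by
    rintro _ ⟨x, ⟨hxB, hxC⟩, rfl⟩
    rw [SetLike.mem_coe, LinearMap.mem_ker, compressedOmega_apply,
      Submodule.starProjection_eq_self_iff.2 hxB] at hxC
    exact (Submodule.starProjection_apply_eq_zero_iff _).1 hxC
  have hle := Submodule.finrank_mono hmap
  rw [← (Submodule.equivMapOfInjective _ (LinearMap.ker_eq_bot.1 (S.ker_Omega h)) _).finrank_eq]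
    at hle
  have horth := Submodule.finrank_add_finrank_orthogonal (LinearMap.ker S.B)
  have hker := S.finrank_ker_B
  rw [finrank_stateSpace] at horth
  omega

theorem isLeast_rhoMin (h : S.η.PosDef) (hR : S.R.rank < N) :
    IsLeast {ρ : ℝ | 0 < ρ ∧ (ρ : ℂ) ∈ spectrum ℂ S.compressedOmega} S.rhoMin := by
  refine isLeast_sInf_of_ofReal_mem_spectrum ?_ fun _ hρ => hρ.2
  by_contra hempty
  have hspec (μ : ℝ) (hμ : (μ : ℂ) ∈ spectrum ℂ S.compressedOmega) : |μ| ≤ 0 := by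
    by_contra! hμ0
    exact hempty ⟨|μ|, hμ0, S.abs_mem_spectrum_compressedOmega hμ⟩
  have hker : LinearMap.ker S.B ≤ LinearMap.ker S.compressedOmega := fun x _ => by
    simpa using norm_apply_le_of_spectrum S.compressedOmega_isSymmetric le_rfl hspec x
  have hle := S.finrank_ker_B_inf_ker_compressedOmega_le h
  rw [inf_eq_left.2 hker] at hle
  have hrank := S.finrank_ker_B
  omega

theorem rhoMin_pos (h : S.η.PosDef) (hR : S.R.rank < N) : 0 < S.rhoMin :=
  (S.isLeast_rhoMin h hR).1.1

theorem rhoMin_le_abs (h : S.η.PosDef) (hR : S.R.rank < N) {μ : ℝ}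
    (hμ : (μ : ℂ) ∈ spectrum ℂ S.compressedOmega) (hμ0 : μ ≠ 0) : S.rhoMin ≤ |μ| :=
  (S.isLeast_rhoMin h hR).2 ⟨abs_pos.2 hμ0, S.abs_mem_spectrum_compressedOmega hμ⟩

/-- The component in `Ker B` of `Ω x⊥`, where `x⊥` is the component of `x` orthogonal to `Ker B`:
the error made when `A(β)` is replaced by the compressed operator. -/
noncomputable def coupling (x : StateSpace N) : StateSpace N :=
  (LinearMap.ker S.B).starProjection (S.Omega ((LinearMap.ker S.B)ᗮ.starProjection x))

theorem starProjection_ker_B_A (β : ℝ) (x : StateSpace N) :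
    (LinearMap.ker S.B).starProjection (S.A β x)
      = S.compressedOmega ((LinearMap.ker S.B).starProjection x) + S.coupling x := by
  have hB : (LinearMap.ker S.B).starProjection (S.B x) = 0 :=
    (Submodule.starProjection_apply_eq_zero_iff _).2
      (apply_mem_orthogonal_ker_of_isSymmetric S.B_isSymmetric x)
  rw [A_apply, map_sub, map_smul, hB, smul_zero, sub_zero, compressedOmega_starProjection,
    compressedOmega_apply, coupling, ← map_add, ← map_add,
    Submodule.starProjection_add_starProjection_orthogonal]

/-- The form `x ↦ ‖Q P x‖² - ‖Q⊥ P x‖²`, where `P` and `Q` are the orthogonal projections onto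
`Ker B` and onto the kernel of the compressed operator `P Ω P`: the Lyapunov form that separates
the eigenvalues of `A(β)` near `0` from the other low-loss ones. -/
noncomputable def compressedForm (x : StateSpace N) : ℝ :=
  projectionForm (LinearMap.ker S.compressedOmega) ((LinearMap.ker S.B).starProjection x)

theorem compressedForm_nonpos_of_mem_orthogonal {x : StateSpace N}
    (hx : x ∈ (LinearMap.ker S.B ⊓ LinearMap.ker S.compressedOmega)ᗮ) :
    S.compressedForm x ≤ 0 :=
  projectionForm_nonpos_of_mem_orthogonal fun y hy => by
    rw [← Submodule.inner_starProjection_left_eq_right]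
    refine hx _ ⟨Submodule.starProjection_apply_mem _ y, ?_⟩
    rwa [SetLike.mem_coe, LinearMap.mem_ker, compressedOmega_starProjection]

theorem continuous_compressedForm : Continuous S.compressedForm :=
  (continuous_projectionForm _).comp (ContinuousLinearMap.continuous _)

theorem compressedForm_smul (a : ℂ) (x : StateSpace N) :
    S.compressedForm (a • x) = ‖a‖ ^ 2 * S.compressedForm x := by
  rw [compressedForm, map_smul, projectionForm_smul, compressedForm]

section HighQ

variable {S} {β : ℝ}

theorem starProjection_ker_B_ne_zero_of_mem_Hll (hβ : 2 * S.omegaMax / S.bMin < β)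
    {x : StateSpace N} (hx : x ∈ S.Hll β) (hx0 : x ≠ 0) :
    (LinearMap.ker S.B).starProjection x ≠ 0 := fun hPx =>
  (projectionForm_ker_B_pos_of_mem_Hll hβ hx hx0).not_ge <|
    projectionForm_nonpos_of_mem_orthogonal <| (Submodule.starProjection_apply_eq_zero_iff _).1 hPx

theorem mul_norm_starProjection_orthogonal_ker_B_le (hβ : 2 * S.omegaMax / S.bMin < β)
    {x : StateSpace N} (hx : x ∈ S.Hll β) :
    (β * S.bMin - 2 * S.omegaMax) * ‖(LinearMap.ker S.B)ᗮ.starProjection x‖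
      ≤ 2 * S.omegaMax * ‖(LinearMap.ker S.B).starProjection x‖ := by
  have hβ0 := pos_of_two_mul_omegaMax_div_lt hβ
  have hform : 0 ≤ projectionForm (LinearMap.ker S.B) (S.A β x) := by
    rcases eq_or_ne (S.A β x) 0 with hzero | hne
    · simp [hzero, projectionForm]
    · exact (projectionForm_ker_B_pos_of_mem_Hll hβ (apply_mem_spectralSubspace _ _ x hx) hne).le
  rw [A_apply_eq_neg_smul_add] at hform
  rw [← S.ker_neg_smul_B hβ0] at hform ⊢
  exact mul_norm_le_of_projectionForm_nonneg (S.neg_smul_B_mem_orthogonal hβ0) S.omegaMax_nonneg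
    (fun _ hu => S.mul_norm_le_norm_neg_smul_B hβ0 hu) (S.norm_Omega_le x) hform

theorem c_eq_div : S.c β = 2 * S.omegaMax ^ 2 / (β * S.bMin - 2 * S.omegaMax) := by
  have hb := S.bMin_pos
  have hgap : β - 2 * S.omegaMax / S.bMin = (β * S.bMin - 2 * S.omegaMax) / S.bMin := by
    field_simp
  rw [c, hgap, inv_div, div_mul_div_cancel₀ hb.ne']

theorem norm_coupling_le (hβ : 2 * S.omegaMax / S.bMin < β) {x : StateSpace N}
    (hx : x ∈ S.Hll β) : ‖S.coupling x‖ ≤ S.c β * ‖(LinearMap.ker S.B).starProjection x‖ := by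
  have hω := S.omegaMax_nonneg
  have hgap : 0 < β * S.bMin - 2 * S.omegaMax := sub_pos.2 ((div_lt_iff₀ S.bMin_pos).1 hβ)
  rw [c_eq_div, div_mul_eq_mul_div, le_div_iff₀ hgap]
  calc ‖S.coupling x‖ * (β * S.bMin - 2 * S.omegaMax)
      ≤ S.omegaMax * ‖(LinearMap.ker S.B)ᗮ.starProjection x‖
        * (β * S.bMin - 2 * S.omegaMax) := by
        gcongr
        exact ((LinearMap.ker S.B).norm_starProjection_apply_le _).trans (S.norm_Omega_le _)
    _ = S.omegaMax * ((β * S.bMin - 2 * S.omegaMax)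
        * ‖(LinearMap.ker S.B)ᗮ.starProjection x‖) := by ring
    _ ≤ S.omegaMax * (2 * S.omegaMax * ‖(LinearMap.ker S.B).starProjection x‖) :=
        mul_le_mul_of_nonneg_left (mul_norm_starProjection_orthogonal_ker_B_le hβ hx) hω
    _ = 2 * S.omegaMax ^ 2 * ‖(LinearMap.ker S.B).starProjection x‖ := by ring

theorem compressedForm_A_lt (h : S.η.PosDef) (hR : S.R.rank < N)
    (hβ : 2 * S.omegaMax / S.bMin < β) (hc : S.c β < S.rhoMin / 2) {x : StateSpace N}
    (hx : x ∈ S.Hll β) (hx0 : x ≠ 0) :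
    S.compressedForm (S.A β x) < (S.rhoMin / 2) ^ 2 * S.compressedForm x := by
  have hρ := S.rhoMin_pos h hR
  have hPx := norm_pos_iff.2 (starProjection_ker_B_ne_zero_of_mem_Hll hβ hx hx0)
  rw [compressedForm, starProjection_ker_B_A]
  refine projectionForm_ker_apply_add_lt
    (apply_mem_orthogonal_ker_of_isSymmetric S.compressedOmega_isSymmetric) (half_pos hρ).le
    (fun u hu => ?_) ((norm_coupling_le hβ hx).trans_lt (mul_lt_mul_of_pos_right hc hPx))
  rw [mul_div_cancel₀ _ two_ne_zero]
  exact mul_norm_le_norm_apply_of_spectrum S.compressedOmega_isSymmetric hρ.le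
    (fun _ => S.rhoMin_le_abs h hR) hu

theorem finrank_spectralSubspace_le_rank_of_norm_lt (h : S.η.PosDef) (hR : S.R.rank < N)
    (hβ : 2 * S.omegaMax / S.bMin < β) (hc : S.c β < S.rhoMin / 2) {s : Set ℂ}
    (hs : s ⊆ S.sigma0 β) (hnorm : ∀ ζ ∈ s, ‖ζ‖ < S.rhoMin / 2) :
    Module.finrank ℂ (spectralSubspace (S.A β) s) ≤ S.R.rank := by
  have hle : spectralSubspace (S.A β) s ≤ S.Hll β := biSup_mono hs
  have hpos {x : StateSpace N} (hx : x ∈ spectralSubspace (S.A β) s) (hx0 : x ≠ 0) :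
      0 < S.compressedForm x := by
    refine pos_of_restrictedSpectrum_lt (apply_mem_spectralSubspace _ _)
      (half_pos (S.rhoMin_pos h hR)) (fun ζ hζ => hnorm ζ ?_)
      S.continuous_compressedForm S.compressedForm_smul
      (fun x hx hx0 => compressedForm_A_lt h hR hβ hc (hle hx) hx0) hx hx0
    rwa [restrictedSpectrum_spectralSubspace (hs.trans Set.inter_subset_left)] at hζ
  refine (finrank_le_of_disjoint_orthogonal (Submodule.disjoint_def.2 fun x hx hxK => ?_)).trans
    (S.finrank_ker_B_inf_ker_compressedOmega_le h)
  by_contra hx0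
  exact (hpos hx hx0).not_ge (S.compressedForm_nonpos_of_mem_orthogonal hxK)

theorem abs_im_lt_abs_re_of_norm_sub_ofReal_le {ζ : ℂ} {μ c : ℝ} (h : ‖ζ - μ‖ ≤ c)
    (hμ : 2 * c < |μ|) : |ζ.im| < |ζ.re| := by
  have him := (Complex.abs_im_le_norm _).trans h
  have hre := (Complex.abs_re_le_norm _).trans h
  rw [Complex.sub_im, Complex.ofReal_im, sub_zero] at him
  rw [Complex.sub_re, Complex.ofReal_re, abs_sub_comm] at hre
  linarith [abs_sub_abs_le_abs_sub μ ζ.re]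

theorem exists_mem_spectrum_compressedOmega_norm_sub_le (hβ : 2 * S.omegaMax / S.bMin < β) {ζ : ℂ}
    (hζ : ζ ∈ S.sigma0 β) :
    ∃ μ : ℝ, (μ : ℂ) ∈ spectrum ℂ S.compressedOmega ∧ ‖ζ - μ‖ ≤ S.c β := by
  rw [← restrictedSpectrum_Hll] at hζ
  obtain ⟨w, hw, hw0, hwζ⟩ := hζ
  set p := (LinearMap.ker S.B).starProjection w
  have hresidual : (1 : ℂ) • S.compressedOmega p - ζ • p = -S.coupling w := by
    rw [one_smul, ← map_smul, ← hwζ, starProjection_ker_B_A, sub_add_cancel_left]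
  obtain ⟨μ, hμ, hμζ⟩ := exists_eigenvalue_norm_sub_le S.compressedOmega_isSymmetric
    (starProjection_ker_B_ne_zero_of_mem_Hll hβ hw hw0)
    (by rw [hresidual, norm_neg]; exact norm_coupling_le hβ hw)
  rw [one_mul, norm_sub_rev] at hμζ
  exact ⟨μ, hμ, hμζ⟩

theorem c_lt_of_cInv_lt (h : S.η.PosDef) {y : ℝ} (hy : 0 < y) (hβ : S.cInv y < β) :
    S.c β < y := by
  have hω := S.omegaMax_pos h
  have hb := S.bMin_pos
  have hgap : 2 * S.omegaMax ^ 2 / S.bMin * y⁻¹ < β - 2 * S.omegaMax / S.bMin :=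
    lt_sub_iff_add_lt.2 hβ
  have hgap0 : 0 < β - 2 * S.omegaMax / S.bMin := lt_of_le_of_lt (by positivity) hgap
  rwa [c, ← div_eq_mul_inv, div_lt_comm₀ hgap0 hy, div_eq_mul_inv]

theorem abs_im_lt_abs_re_of_cInv_lt (h : S.η.PosDef) (hR : S.R.rank < N)
    (hβ : 2 * S.omegaMax / S.bMin < β)
    (hβ' : 2 * (S.dual h).omegaMax / (S.dual h).bMin < β) (hc : S.cInv (S.rhoMin / 2) < β)
    {ζ : ℂ} (hζ : ζ ∈ S.sigmaMid β) : |ζ.im| < |ζ.re| := by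
  have hcβ : S.c β < S.rhoMin / 2 := c_lt_of_cInv_lt h (half_pos (S.rhoMin_pos h hR)) hc
  have hζ₀ : ζ ∈ S.sigma0 β := (sigma0_eq_union h).superset (Or.inr hζ)
  obtain ⟨μ, hμ, hμζ⟩ := exists_mem_spectrum_compressedOmega_norm_sub_le hβ hζ₀
  refine abs_im_lt_abs_re_of_norm_sub_ofReal_le hμζ ?_
  suffices hμ0 : μ ≠ 0 by linarith [S.rhoMin_le_abs h hR hμ hμ0]
  rintro rfl
  rw [Complex.ofReal_zero, sub_zero] at hμζ
  have hζ_lt : ‖ζ‖ < S.rhoMin / 2 := hμζ.trans_lt hcβ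
  -- `sigmaLow` already accounts for all `N_R` eigenvalues below `ρ_min / 2`.
  have hcount := finrank_spectralSubspace_le_rank_of_norm_lt (s := insert ζ (S.sigmaLow β)) h hR hβ
    hcβ (Set.insert_subset hζ₀ fun ξ hξ => (sigma0_eq_union h).superset (Or.inl hξ))
    (Set.forall_mem_insert.2 ⟨hζ_lt, fun ξ hξ => (hξ.2.trans_le hζ.2.1).trans hζ_lt⟩)
  refine hcount.not_gt ((finrank_Hll0 h hβ').symm.trans_lt ?_)
  exact finrank_spectralSubspace_lt_insert hζ.1
    fun hlow => Set.disjoint_left.1 disjoint_sigmaLow_sigmaMid hlow hζ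

theorem abs_im_lt_abs_re_of_neg_inv {ζ : ℂ} (h : |(-ζ⁻¹).im| < |(-ζ⁻¹).re|) :
    |ζ.im| < |ζ.re| := by
  rw [Complex.neg_im, Complex.neg_re, Complex.inv_im, Complex.inv_re, abs_neg, abs_neg, abs_div,
    abs_div, abs_neg] at h
  contrapose! h
  gcongr

theorem abs_im_lt_abs_re (h : S.η.PosDef) (hR : S.R.rank < N) (hβ : S.beta2 h < β)
    {ζ : ℂ} (hζ : ζ ∈ S.sigmaMid β) : |ζ.im| < |ζ.re| := by
  obtain ⟨hcInv, hloss⟩ := max_lt_iff.1 hβ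
  obtain ⟨hβω, hβω'⟩ := max_lt_iff.1 hloss
  rcases min_lt_iff.1 hcInv with hc | hc
  · exact abs_im_lt_abs_re_of_cInv_lt h hR hβω hβω' hc hζ
  · rw [sigmaMid_eq_image h] at hζ
    obtain ⟨ξ, hξ, rfl⟩ := hζ
    apply abs_im_lt_abs_re_of_neg_inv
    rw [neg_inv_neg_inv]
    exact abs_im_lt_abs_re_of_cInv_lt (S := S.dual h) S.α_posDef hR hβω' hβω hc hξ

end HighQ

theorem half_lt_qFactor {ζ : ℂ} (him : ζ.im ≤ 0) (hlt : |ζ.im| < |ζ.re|) :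
    ((1 / 2 : ℝ) : EReal) < qFactor ζ := by
  have hζ : ζ ≠ 0 := by rintro rfl; simp at hlt
  rw [qFactor, if_neg hζ]
  split_ifs with him0
  · exact EReal.coe_lt_top _
  · have him_pos : 0 < -ζ.im := neg_pos.2 (him.lt_of_ne him0)
    have hratio : 1 < |ζ.re| / -ζ.im := by
      rwa [one_lt_div him_pos, ← abs_of_nonpos him]
    rw [EReal.coe_lt_coe_iff]
    linarith

theorem deriv_exp_smul {E : Type*} [NormedAddCommGroup E] [NormedSpace ℂ E] (a : ℂ) (q : E) :
    deriv (fun t : ℝ => Complex.exp (a * t) • q) = fun t : ℝ => Complex.exp (a * t) • a • q := by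
  funext t
  have hlin : HasDerivAt (fun t : ℝ => a * (t : ℂ)) a t := by
    simpa using (Complex.ofRealCLM.hasDerivAt (x := t)).const_mul a
  rw [(hlin.cexp.smul_const q).deriv, smul_smul]

theorem isEigenmode_iff {β : ℝ} {ζ : ℂ} {q : Fin N → ℂ} :
    S.IsEigenmode β ζ q ↔ q ≠ 0 ∧
      (-ζ ^ 2) • (S.α.map Complex.ofReal).mulVec q
        + (-Complex.I * ζ) • ((S.damping β).map Complex.ofReal).mulVec q
        + (S.η.map Complex.ofReal).mulVec q = 0 := by
  have hsmooth : ContDiff ℝ 2 (fun t : ℝ => Complex.exp (-Complex.I * ζ * t) • q) :=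
    (contDiff_const.mul Complex.ofRealCLM.contDiff).cexp.smul contDiff_const
  have hsq : -Complex.I * ζ * (-Complex.I * ζ) = -ζ ^ 2 := by
    linear_combination ζ ^ 2 * Complex.I_sq
  rw [IsEigenmode, IsSolution, and_iff_right hsmooth, ← damping]
  simp only [deriv_exp_smul, Matrix.mulVec_smul, ← smul_add, smul_smul (-Complex.I * ζ), hsq,
    smul_eq_zero, Complex.exp_ne_zero, false_or, forall_const]

theorem exists_components_of_A_apply_eq_smul {β : ℝ} {ζ : ℂ} {w : StateSpace N}
    (hw : S.A β w = ζ • w) :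
    ∃ q z : Fin N → ℂ,
      WithLp.ofLp w = Sum.elim (((CFC.sqrt S.α).map Complex.ofReal).mulVec q) z ∧
      (-Complex.I) • (((S.damping β).map Complex.ofReal).mulVec q
        + (S.Kq.map Complex.ofReal).mulVec z) = ζ • (S.α.map Complex.ofReal).mulVec q ∧
      Complex.I • (S.Kq.map Complex.ofReal).mulVec q = ζ • z := by
  set p : Fin N → ℂ := WithLp.ofLp w ∘ Sum.inl
  set z : Fin N → ℂ := WithLp.ofLp w ∘ Sum.inr
  set q : Fin N → ℂ := (S.Kp.map Complex.ofReal).mulVec p with hq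
  have hwpz : WithLp.ofLp w = Sum.elim p z := (Sum.elim_comp_inl_inr _).symm
  have sqrt_Kp_mulVec (v : Fin N → ℂ) : ((CFC.sqrt S.α).map Complex.ofReal).mulVec
      ((S.Kp.map Complex.ofReal).mulVec v) = v := by
    rw [Matrix.mulVec_mulVec, ← map_ofReal_mul, sqrt_mul_Kp,
      Matrix.map_one _ Complex.ofReal_zero Complex.ofReal_one, Matrix.one_mulVec]
  have hp : ((CFC.sqrt S.α).map Complex.ofReal).mulVec q = p := sqrt_Kp_mulVec p
  have hα : ((CFC.sqrt S.α).map Complex.ofReal).mulVec p = (S.α.map Complex.ofReal).mulVec q := by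
    rw [← hp, Matrix.mulVec_mulVec, ← map_ofReal_mul,
      CFC.sqrt_mul_sqrt_self _ (Matrix.nonneg_iff_posSemidef.2 S.α_posDef.posSemidef)]
  have hblocks : (S.AMatrix β).mulVec (Sum.elim p z) = Sum.elim (ζ • p) (ζ • z) := by
    rw [A_eq_toEuclideanLin, Matrix.toLpLin_apply] at hw
    rw [← hwpz]
    exact (congrArg WithLp.ofLp hw).trans (Sum.elim_comp_inl_inr _).symm
  rw [AMatrix, Matrix.fromBlocks_mulVec, Sum.elim_comp_inl, Sum.elim_comp_inr,
    Sum.elim_eq_iff, Matrix.zero_mulVec, add_zero] at hblocks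
  simp only [Matrix.smul_mulVec, map_ofReal_mul, ← Matrix.mulVec_mulVec, ← hq, ← smul_add,
    ← Matrix.mulVec_add] at hblocks
  refine ⟨q, z, by rw [hp, hwpz], ?_, hblocks.2⟩
  rw [← hα, ← Matrix.mulVec_smul, ← hblocks.1, Matrix.mulVec_smul, sqrt_Kp_mulVec]

theorem exists_isEigenmode (h : S.η.PosDef) {β : ℝ} {ζ : ℂ} (hζ : ζ ∈ spectrum ℂ (S.A β)) :
    ∃ q, S.IsEigenmode β ζ q := by
  obtain ⟨w, hw0, hw⟩ := mem_spectrum_iff_exists_eigenvector.1 hζ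
  have hζ0 : ζ ≠ 0 := norm_pos_iff.1 (S.norm_pos_of_mem_spectrum_A h hζ)
  obtain ⟨q, z, hwqz, hqz, hz⟩ := S.exists_components_of_A_apply_eq_smul hw
  refine ⟨q, S.isEigenmode_iff.2 ⟨?_, ?_⟩⟩
  · rintro rfl
    rw [Matrix.mulVec_zero, smul_zero, eq_comm, smul_eq_zero] at hz
    refine hw0 ((WithLp.ofLp_eq_zero 2).1 ?_)
    rw [hwqz, hz.resolve_left hζ0, Matrix.mulVec_zero]
    ext (i | i) <;> rfl
  · have hη : (S.η.map Complex.ofReal).mulVec q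
        = (-Complex.I * ζ) • (S.Kq.map Complex.ofReal).mulVec z := by
      rw [mul_smul, ← Matrix.mulVec_smul, ← hz, Matrix.mulVec_smul, Matrix.mulVec_mulVec,
        ← map_ofReal_mul, Kq,
        CFC.sqrt_mul_sqrt_self _ (Matrix.nonneg_iff_posSemidef.2 S.η_posSemidef), smul_smul,
        neg_mul, Complex.I_mul_I, neg_neg, one_smul]
    rw [hη, neg_smul, pow_two, mul_smul, ← hqz]
    module

section HighQ

variable {S} {β : ℝ}

theorem re_ne_zero_of_mem_restrictedSpectrum_Hll1 (h : S.η.PosDef) (hR : S.R.rank < N)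
    (hβ : S.beta2 h < β) {ζ : ℂ} (hζ : ζ ∈ restrictedSpectrum (S.A β) (S.Hll1 β)) : ζ.re ≠ 0 := by
  rw [restrictedSpectrum_Hll1] at hζ
  exact abs_pos.1 ((abs_nonneg _).trans_lt (abs_im_lt_abs_re h hR hβ hζ))

theorem half_lt_qFactor_of_mem_restrictedSpectrum_Hll1 (h : S.η.PosDef) (hR : S.R.rank < N)
    (hβ : S.beta2 h < β) {ζ : ℂ} (hζ : ζ ∈ restrictedSpectrum (S.A β) (S.Hll1 β)) :
    ((1 / 2 : ℝ) : EReal) < qFactor ζ := by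
  have hβ0 : 0 < β :=
    pos_of_two_mul_omegaMax_div_lt ((le_max_left _ _).trans_lt (max_lt_iff.1 hβ).2)
  rw [restrictedSpectrum_Hll1] at hζ
  exact half_lt_qFactor (S.im_nonpos_of_mem_spectrum hβ0.le hζ.1) (abs_im_lt_abs_re h hR hβ hζ)

theorem restrictedSpectrum_Hll1_nonempty (h : S.η.PosDef) (hR : S.R.rank < N)
    (hβ : 2 * S.omegaMax / S.bMin < β) (hβ' : 2 * (S.dual h).omegaMax / (S.dual h).bMin < β) :
    (restrictedSpectrum (S.A β) (S.Hll1 β)).Nonempty := by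
  rw [restrictedSpectrum_Hll1]
  by_contra! hempty
  have hfinrank := finrank_Hll1 h hβ hβ'
  rw [Hll1, hempty, spectralSubspace, iSup_emptyset, finrank_bot] at hfinrank
  omega

theorem exists_isLeast_qFactor (h : S.η.PosDef) (hR : S.R.rank < N)
    (hβ : 2 * S.omegaMax / S.bMin < β) (hβ' : 2 * (S.dual h).omegaMax / (S.dual h).bMin < β) :
    ∃ m, IsLeast (qFactor '' restrictedSpectrum (S.A β) (S.Hll1 β)) m := by
  have hfin : (restrictedSpectrum (S.A β) (S.Hll1 β)).Finite :=
    (Module.End.finite_spectrum (S.A β)).subset (restrictedSpectrum_subset_spectrum _ _)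
  obtain ⟨m, hm, hle⟩ := Set.exists_min_image _ id (hfin.image qFactor)
    ((restrictedSpectrum_Hll1_nonempty h hR hβ hβ').image _)
  exact ⟨m, hm, hle⟩

theorem isUnderdamped_of_mem_restrictedSpectrum_Hll1 (h : S.η.PosDef) (hR : S.R.rank < N)
    {ζ : ℝ → ℂ}
    (hζ : ∀ β, S.beta2 h < β → ζ β ∈ restrictedSpectrum (S.A β) (S.Hll1 β)) :
    S.IsUnderdamped ζ := by
  refine ⟨max 0 (S.beta2 h), le_max_left _ _, fun β hβ => ?_⟩
  have hβ₂ : S.beta2 h < β := (le_max_right _ _).trans_lt hβ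
  exact ⟨S.exists_isEigenmode h (restrictedSpectrum_subset_spectrum _ _ (hζ β hβ₂)),
    re_ne_zero_of_mem_restrictedSpectrum_Hll1 h hR hβ₂ (hζ β hβ₂)⟩

end HighQ

end LagrangianSystem

theorem mainTheorem5 {N : ℕ} (S : LagrangianSystem N) (hη : S.η.PosDef) (hR : S.R.rank < N) :
    (∀ β : ℝ, S.beta2 hη < β →
      S.ModalDichotomyI β ∧
      S.ModalDichotomyII hη β ∧
      (∃ m : EReal, IsLeast (qFactor '' restrictedSpectrum (S.A β) (S.Hll1 β)) m ∧
        ((1 / 2 : ℝ) : EReal) < m) ∧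
      (∀ ζ ∈ restrictedSpectrum (S.A β) (S.Hll1 β),
        ((1 / 2 : ℝ) : EReal) < qFactor ζ ∧ ζ.re ≠ 0)) ∧
    (∀ ζ : ℝ → ℂ,
      (∀ β : ℝ, S.beta2 hη < β → ζ β ∈ restrictedSpectrum (S.A β) (S.Hll1 β)) →
        S.IsUnderdamped ζ) := by
  refine ⟨fun β hβ => ?_, fun _ =>
    LagrangianSystem.isUnderdamped_of_mem_restrictedSpectrum_Hll1 hη hR⟩
  obtain ⟨hβω, hβω'⟩ := max_lt_iff.1 (max_lt_iff.1 hβ).2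
  have hhalf (ζ : ℂ) (hζ : ζ ∈ restrictedSpectrum (S.A β) (S.Hll1 β)) :
      ((1 / 2 : ℝ) : EReal) < qFactor ζ :=
    LagrangianSystem.half_lt_qFactor_of_mem_restrictedSpectrum_Hll1 hη hR hβ hζ
  refine ⟨LagrangianSystem.modalDichotomyI hβω, LagrangianSystem.modalDichotomyII hη hβω hβω',
    ?_, fun ζ hζ => ⟨hhalf ζ hζ,
      LagrangianSystem.re_ne_zero_of_mem_restrictedSpectrum_Hll1 hη hR hβ hζ⟩⟩
  obtain ⟨m, hm⟩ := LagrangianSystem.exists_isLeast_qFactor hη hR hβω hβω'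
  refine ⟨m, hm, ?_⟩
  obtain ⟨ζ, hζ, rfl⟩ := hm.1
  exact hhalf ζ hζ
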